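/- Let $a_n>0$ and $b_n\in\mathbb R$ ($n=0,1,2,\dots$), and let $P_n$ be the orthogonal polynomials defined by $P_{-1}(z)=0$, $P_0(z)=1$ and $$a_{n-1}P_{n-1}(z)+b_nP_n(z)+a_nP_{n+1}(z)=zP_n(z),\qquad n\ge 0,\ z\in\mathbb C .$$ Suppose that, as $n\to\infty$, $$a_n=n^\sigma\bigl(1+\alpha n^{-1}+O(n^{-2})\bigr),\qquad b_n=2\gamma n^\sigma\bigl(1+\beta n^{-1}+O(n^{-2})\bigr)$$ with real $\alpha,\beta,\gamma,\sigma$, where $|\gamma|=1$ and $\sigma>3/2$. Put $\nu=-\operatorname{sgn}\gamma$, $\tau=2\beta-2\alpha+\sigma$ and $\varrho=\min\{\sigma-3/2,\,1/2\}$. (1) If $\tau<0$, there are functions $\kappa_\pm:\mathbb C\to\mathbb C$ such that $$P_n(z)=\nu^n n^{-\sigma/2+1/4}\Bigl(\kappa_+(z)e^{-2i\sqrt{|\tau|n}}+\kappa_-(z)e^{2i\sqrt{|\tau|n}}+O(n^{-\varrho})\Bigr),\qquad n\to\infty,$$ for all $z\in\mathbb C$, uniformly in $z$ from compact subsets of $\mathbb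 C$. (2) If $\tau>0$, there is a function $\kappa:\mathbb C\to\mathbb C$ such that $\kappa(z)=0$ if and only if $\sum_{n\ge0}|P_n(z)|^2<\infty$, $$P_n(z)=\nu^n n^{-\sigma/2+1/4}e^{2\sqrt{\tau n}}\bigl(\kappa(z)+O(n^{-\varrho})\bigr),\qquad n\to\infty,$$ for all $z\in\mathbb C$, uniformly in $z$ from compact subsets of $\mathbb C$, and $$P_n(z)=\kappa(z)\,\nu^n n^{-\sigma/2+1/4}e^{2\sqrt{\tau n}}\bigl(1+O(n^{-\varrho})\bigr),\qquad n\to\infty,$$ for all $z$ with $\kappa(z)\ne0$, uniformly in $z$ from compact subsets of $\{z\in\mathbb C:\kappa(z)\neq0\}$. -/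

import Mathlib

open Filter Asymptotics

/-- The orthogonal polynomials attached to the Jacobi coefficients `a`, `b`: the polynomials given by
`P₋₁ = 0`, `P₀ = 1` and `a (n-1) P (n-1) + b n P n + a n P (n+1) = X P n` for `n ≥ 0`,
solved successively for `P (n+1)` (all `a n` are positive). -/
noncomputable def orthPoly (a b : ℕ → ℝ) : ℕ → Polynomial ℝ
  | 0 => 1
  | 1 => Polynomial.C (a 0)⁻¹ * (Polynomial.X - Polynomial.C (b 0))
  | n + 2 => Polynomial.C (a (n + 1))⁻¹ *
      ((Polynomial.X - Polynomial.C (b (n + 1))) * orthPoly a b (n + 1)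
        - Polynomial.C (a n) * orthPoly a b n)

/-- The value `P_n(z)` of the `n`-th orthogonal polynomial at a complex point `z`. -/
noncomputable def orthPolyAt (a b : ℕ → ℝ) (n : ℕ) (z : ℂ) : ℂ :=
  Polynomial.aeval z (orthPoly a b n)

/-- The recurrence relation at `n = 0`, where `P₋₁ = 0`. -/
theorem orthPolyAt_recurrence_zero (a b : ℕ → ℝ) (ha : ∀ n, 0 < a n) (z : ℂ) :
    (b 0 : ℂ) * orthPolyAt a b 0 z + a 0 * orthPolyAt a b 1 z = z * orthPolyAt a b 0 z := by
  have h : (a 0 : ℂ) ≠ 0 := by exact_mod_cast (ha 0).ne'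
  simp only [orthPolyAt, orthPoly, map_mul, map_sub, map_one, Polynomial.aeval_X,
    Polynomial.aeval_C, Complex.coe_algebraMap, Complex.ofReal_inv]
  field_simp
  ring

/-- The recurrence relation at `n + 1`. -/
theorem orthPolyAt_recurrence_succ (a b : ℕ → ℝ) (ha : ∀ n, 0 < a n) (n : ℕ) (z : ℂ) :
    (a n : ℂ) * orthPolyAt a b n z + b (n + 1) * orthPolyAt a b (n + 1) z
      + a (n + 1) * orthPolyAt a b (n + 2) z = z * orthPolyAt a b (n + 1) z := by
  have h : (a (n + 1) : ℂ) ≠ 0 := by exact_mod_cast (ha (n + 1)).ne'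
  simp only [orthPolyAt, orthPoly, map_mul, map_sub, Polynomial.aeval_X,
    Polynomial.aeval_C, Complex.coe_algebraMap, Complex.ofReal_inv]
  field_simp
  ring

/-- `ε n z = O(n ^ (-ϱ))` as `n → ∞`, uniformly in `z` from compact subsets of `U`. -/
def UniformBigOOnCompacts (ε : ℕ → ℂ → ℂ) (ϱ : ℝ) (U : Set ℂ) : Prop :=
  ∀ K : Set ℂ, K ⊆ U → IsCompact K →
    ∃ C : ℝ, ∀ᶠ n : ℕ in atTop, ∀ z ∈ K, ‖ε n z‖ ≤ C * (n : ℝ) ^ (-ϱ)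

/-!
Write `P n = ν ^ n * Q n`. Since `|γ| = 1`, the recurrence for `Q` is a small perturbation of a
discretised second order differential equation `u'' = (τ / t) * u` (after removal of the factor
`t ^ (-σ / 2)`), whose Liouville–Green solutions are `t ^ (1 / 4) * exp (± 2 * s * √t)` with
`s ^ 2 = τ`. The corresponding sequences `A^± n = n ^ (1 / 4 - σ / 2) * exp (± 2 * s * √n)`
(`wkbSeq`) solve the recurrence for `Q` up to a relative error `O(n ^ (σ - 2))`
(`wkbSeq_residual`): the third order expansion `isBigO_step_expansion` of `A (n ± 1) / A n` in
powers of `n ^ (-1 / 2)` shows that all larger terms cancel. The weighted Casoratian of `A^+` and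
`A^-` tends to `2 * s ≠ 0` (`isBigO_casoratian_wkbSeq`).

Variation of parameters then writes `Q` as a combination of `A^±` with slowly varying coefficients
(`amplitude`, `eq_amplitude_mul_add`). After rescaling the second coefficient by `A^- / A^+`, the
two coefficients obey a diagonal recursion up to an error of relative size `n ^ (-1 - ϱ)`, where the
spectral parameter accounts for `ϱ ≤ σ - 3 / 2` and the residual of the ansatz for `ϱ ≤ 1 / 2`
(`exists_almostDiagonal`). A Gronwall argument yields convergence of the amplitude of a non-decaying
ansatz at the rate `n ^ (-ϱ)`, locally uniformly in `z` (`exists_amplitude_limit`).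

For `τ < 0` both `s = I * √|τ|` and `-s` are admissible, and this gives both `κ_±`. For `τ > 0` the
contribution of `A^-` is damped (`exists_amplitude_neg_bound`), and `κ` is the limit of the
amplitude of `A^+`. If `κ z = 0`, an invariant cone argument
(`AlmostDiagonal.exists_norm_le_of_tendsto_zero`) forces `Q` to be of the size of `A^-`, hence
square summable; if `κ z ≠ 0`, then `|Q n|` tends to infinity.
-/

/-! ### Expansion of the ratios of the ansatz -/

/-- Asymptotic expansions with a common error term may be multiplied. -/
theorem isBigO_mul_sub_mul {ι : Type*} {l : Filter ι} {f g p q : ι → ℂ} {h : ι → ℝ}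
    (hf : (fun i => f i - p i) =O[l] h) (hg : (fun i => g i - q i) =O[l] h)
    (hg1 : g =O[l] (fun _ => (1 : ℝ))) (hp1 : p =O[l] (fun _ => (1 : ℝ))) :
    (fun i => f i * g i - p i * q i) =O[l] h := by
  have h1 := hf.mul hg1
  have h2 := hp1.mul hg
  simp only [mul_one, one_mul] at h1 h2
  exact (h1.add h2).congr_left fun i => by ring

theorem isBigO_one_add_rpow_sub (p : ℝ) :
    (fun y : ℝ => (1 + y) ^ p - (1 + p * y)) =O[nhds 0] (fun y : ℝ => y ^ 2) := by
  have h := (Real.one_add_rpow_hasFPowerSeriesAt_zero (a := p)).isBigO_sub_partialSum_pow 2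
  have h2 : (fun y : ℝ => ‖y‖ ^ 2) = fun y : ℝ => y ^ 2 := by
    funext y; simp
  rw [h2] at h
  refine h.congr_left fun y => ?_
  simp [FormalMultilinearSeries.partialSum, Finset.sum_range_succ, binomialSeries,
    FormalMultilinearSeries.coeff_ofScalars]
  ring

theorem isBigO_inv_sqrt_one_add_add_one_sub :
    (fun y : ℝ => 1 / (√(1 + y) + 1) - (1 / 2 - y / 8)) =O[nhds 0] (fun y : ℝ => y ^ 2) := by
  refine IsBigO.of_bound 1 ?_
  filter_upwards [eventually_gt_nhds (show (-1 : ℝ) < 0 by norm_num)] with y hy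
  have hw : 0 ≤ √(1 + y) := Real.sqrt_nonneg _
  have hsq : √(1 + y) ^ 2 = 1 + y := Real.sq_sqrt (by linarith)
  generalize √(1 + y) = w at hw hsq ⊢
  obtain rfl : y = w ^ 2 - 1 := by linarith
  -- both sides are rational in `w = √(1 + y)`, and `w = 1` is a double zero of the difference
  have e : 1 / (w + 1) - (1 / 2 - (w ^ 2 - 1) / 8)
      = (w ^ 2 - 1) ^ 2 * ((w + 3) / (8 * (w + 1) ^ 3)) := by
    field_simp
    ring
  have hb : (w + 3) / (8 * (w + 1) ^ 3) ≤ 1 := by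
    rw [div_le_one (by positivity)]
    nlinarith [pow_nonneg hw 2, pow_nonneg hw 3]
  rw [e, norm_mul, Real.norm_of_nonneg (show 0 ≤ (w + 3) / (8 * (w + 1) ^ 3) by positivity),
    one_mul]
  exact mul_le_of_le_one_right (norm_nonneg _) hb

theorem isBigO_one_of_continuous {f : ℝ → ℂ} (hf : Continuous f) :
    f =O[nhds 0] (fun _ => (1 : ℝ)) :=
  (hf.tendsto 0).isBigO_one ℝ

theorem isBigO_continuous_mul_pow {f : ℝ → ℂ} (hf : Continuous f) (m : ℕ) :
    (fun x : ℝ => f x * (x : ℂ) ^ m) =O[nhds 0] (fun x : ℝ => x ^ m) := by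
  have h : (fun x : ℝ => (x : ℂ) ^ m) =O[nhds 0] (fun x : ℝ => x ^ m) :=
    IsBigO.of_bound 1 (Eventually.of_forall fun x => by simp)
  simpa using (isBigO_one_of_continuous hf).mul h

theorem isBigO_cexp_sub_cubic (c d : ℂ) {g : ℝ → ℂ}
    (hg : (fun x : ℝ => g x - (c * x + d * x ^ 3)) =O[nhds 0] (fun x : ℝ => x ^ 4)) :
    (fun x : ℝ => Complex.exp (g x) - (1 + c * x + c ^ 2 / 2 * x ^ 2 + (c ^ 3 / 6 + d) * x ^ 3))
      =O[nhds 0] (fun x : ℝ => x ^ 4) := by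
  have hpx : ∀ m : ℕ, (fun x : ℝ => x ^ (m + 1)) =O[nhds 0] (fun x : ℝ => x) := fun m => by
    have : (fun x : ℝ => x ^ m) =O[nhds 0] (fun _ => (1 : ℝ)) :=
      ((continuous_pow m).tendsto 0).isBigO_one ℝ
    simpa [pow_succ] using this.mul (isBigO_refl (fun x : ℝ => x) _)
  have hgx : g =O[nhds 0] (fun x : ℝ => x) := by
    have h1 : (fun x : ℝ => c * x + d * x ^ 3) =O[nhds 0] (fun x : ℝ => x) := by
      have := isBigO_continuous_mul_pow (f := fun x : ℝ => c + d * x ^ 2) (by fun_prop) 1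
      simp only [pow_one] at this
      exact this.congr_left fun x => by ring
    exact ((hg.trans (hpx 3)).add h1).congr_left fun x => by ring
  have hx1 : (fun x : ℝ => x) =O[nhds 0] (fun _ => (1 : ℝ)) :=
    (continuous_id.tendsto (0 : ℝ)).isBigO_one ℝ
  have hg1 : g =O[nhds 0] (fun _ => (1 : ℝ)) := hgx.trans hx1
  have hg0 : Tendsto g (nhds 0) (nhds 0) := hgx.trans_tendsto (continuous_id.tendsto (0 : ℝ))
  have hq1 : (fun x : ℝ => c * x + d * x ^ 3) =O[nhds 0] (fun _ => (1 : ℝ)) :=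
    isBigO_one_of_continuous (by fun_prop)
  have hexp := ((Complex.exp_sub_sum_range_isBigO_pow 4).comp_tendsto hg0).trans
    (hgx.pow 4)
  have h2 := isBigO_mul_sub_mul hg hg hg1 hq1
  have hqq1 : (fun x : ℝ => (c * x + d * x ^ 3) * (c * x + d * x ^ 3))
      =O[nhds 0] (fun _ => (1 : ℝ)) := isBigO_one_of_continuous (by fun_prop)
  have h3 := isBigO_mul_sub_mul h2 hg hg1 hqq1
  -- the terms of order at least four in the cubic Taylor polynomial of `exp` at `c * x + d * x ^ 3`
  have hrest : (fun x : ℝ => (c * d + d ^ 2 / 2 * x ^ 2 + (c ^ 2 * d / 2 * x + c * d ^ 2 / 2 * x ^ 3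
      + d ^ 3 / 6 * x ^ 5)) * (x : ℂ) ^ 4) =O[nhds 0] (fun x : ℝ => x ^ 4) :=
    isBigO_continuous_mul_pow (by fun_prop) 4
  refine ((((hexp.add hg).add (h2.const_mul_left (1 / 2))).add
    (h3.const_mul_left (1 / 6))).add hrest).congr_left fun x => ?_
  simp [Finset.sum_range_succ, Nat.factorial]
  ring

/-- The quotient `wkb p s (t + ζ) / wkb p s t` of two values of the ansatz, as a function of
`x = 1 / √t`. It is analytic at `x = 0`: the phase `2 * s * (√(t + ζ) - √t)` is written in its
rationalised form. -/
noncomputable def stepRatio (p : ℝ) (s : ℂ) (ζ x : ℝ) : ℂ :=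
  (((1 + ζ * x ^ 2) ^ p : ℝ) : ℂ)
    * Complex.exp (2 * s * ((ζ * x / (√(1 + ζ * x ^ 2) + 1) : ℝ) : ℂ))

/-- The expansion of `stepRatio` to third order. An error `O(x ^ 4) = O(1 / t ^ 2)` is what the
approximation of solutions requires. -/
theorem isBigO_step_expansion (p : ℝ) (s : ℂ) (ζ : ℝ) :
    (fun x : ℝ => stepRatio p s ζ x - (1 + s * ζ * x + (s ^ 2 * ζ ^ 2 / 2 + p * ζ) * x ^ 2
        + (s ^ 3 * ζ ^ 3 / 6 - s * ζ ^ 2 / 4 + p * s * ζ ^ 2) * x ^ 3))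
      =O[nhds 0] (fun x : ℝ => x ^ 4) := by
  have hy : Tendsto (fun x : ℝ => ζ * x ^ 2) (nhds 0) (nhds 0) := by
    have : Continuous fun x : ℝ => ζ * x ^ 2 := by fun_prop
    simpa using this.tendsto 0
  have hy2 : ((fun y : ℝ => y ^ 2) ∘ fun x : ℝ => ζ * x ^ 2) =O[nhds 0] (fun x : ℝ => x ^ 4) := by
    refine IsBigO.of_bound (‖ζ ^ 2‖) (Eventually.of_forall fun x => le_of_eq ?_)
    rw [← norm_mul]; congr 1; simp only [Function.comp]; ring
  have hpow : (fun x : ℝ => (((1 + ζ * x ^ 2) ^ p : ℝ) : ℂ) - (1 + p * ζ * (x : ℂ) ^ 2))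
      =O[nhds 0] (fun x : ℝ => x ^ 4) := by
    have h := ((isBigO_one_add_rpow_sub p).comp_tendsto hy).trans hy2
    rw [← Complex.isBigO_ofReal_left] at h
    refine h.congr_left fun x => ?_
    simp only [Function.comp]; push_cast; ring
  have hphase : (fun x : ℝ => 2 * s * ((ζ * x / (√(1 + ζ * x ^ 2) + 1) : ℝ) : ℂ)
      - ((s * ζ) * x + (-(s * ζ ^ 2 / 4)) * x ^ 3)) =O[nhds 0] (fun x : ℝ => x ^ 4) := by
    have h := (isBigO_inv_sqrt_one_add_add_one_sub.comp_tendsto hy).trans hy2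
    rw [← Complex.isBigO_ofReal_left] at h
    have h1 := (isBigO_one_of_continuous (f := fun x : ℝ => 2 * s * ζ * x) (by fun_prop)).mul h
    simp only [one_mul] at h1
    refine h1.congr_left fun x => ?_
    simp only [Function.comp]; push_cast; ring
  have hexp := isBigO_cexp_sub_cubic _ _ hphase
  have hexp1 : (fun x : ℝ => Complex.exp (2 * s * ((ζ * x / (√(1 + ζ * x ^ 2) + 1) : ℝ) : ℂ)))
      =O[nhds 0] (fun _ => (1 : ℝ)) := by
    refine isBigO_one_of_continuous ?_
    have : Continuous fun x : ℝ => ζ * x / (√(1 + ζ * x ^ 2) + 1) := by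
      refine Continuous.div (by fun_prop) (by fun_prop) fun x => ?_
      have := Real.sqrt_nonneg (1 + ζ * x ^ 2)
      positivity
    fun_prop
  have h := isBigO_mul_sub_mul hpow hexp hexp1 (isBigO_one_of_continuous (by fun_prop))
  have hrest := isBigO_continuous_mul_pow (f := fun x : ℝ => p * ζ * ((s * ζ) ^ 2 / 2)
    + p * ζ * ((s * ζ) ^ 3 / 6 + -(s * ζ ^ 2 / 4)) * x) (by fun_prop) 4
  refine (h.add hrest).congr_left fun x => ?_
  rw [stepRatio]
  ring

/-! ### The Liouville–Green ansatz and its residual -/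

/-- The Liouville–Green (WKB) ansatz `t ^ p * exp (2 * s * √t)`. -/
noncomputable def wkb (p : ℝ) (s : ℂ) (t : ℝ) : ℂ :=
  ((t ^ p : ℝ) : ℂ) * Complex.exp (2 * s * (√t : ℝ))

theorem wkb_ne_zero (p : ℝ) (s : ℂ) {t : ℝ} (ht : 0 < t) : wkb p s t ≠ 0 :=
  mul_ne_zero (by exact_mod_cast (Real.rpow_pos_of_pos ht p).ne') (Complex.exp_ne_zero _)

theorem wkb_mul_wkb_neg (p : ℝ) (s : ℂ) {t : ℝ} (ht : 0 < t) :
    wkb p s t * wkb p (-s) t = ((t ^ (2 * p) : ℝ) : ℂ) := by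
  rw [wkb, wkb, mul_mul_mul_comm, ← Complex.exp_add, ← Complex.ofReal_mul, ← Real.rpow_add ht]
  rw [show 2 * s * (√t : ℝ) + 2 * -s * (√t : ℝ) = 0 by ring, Complex.exp_zero, mul_one, two_mul]

theorem wkb_add (p : ℝ) (s : ℂ) {t ζ : ℝ} (ht : 0 < t) (hζ : 0 ≤ t + ζ) :
    wkb p s (t + ζ) = wkb p s t * stepRatio p s ζ (1 / √t) := by
  have hx : (1 / √t) ^ 2 = 1 / t := by rw [div_pow, Real.sq_sqrt ht.le, one_pow]
  have hst : 0 < √t := Real.sqrt_pos.2 ht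
  have e1 : t + ζ = t * (1 + ζ * (1 / t)) := by field_simp
  have hw0 : 0 ≤ 1 + ζ * (1 / t) := by
    by_contra! h
    nlinarith
  have e2 : √(t + ζ) = √t + ζ * (1 / √t) / (√(1 + ζ * (1 / √t) ^ 2) + 1) := by
    rw [hx, e1, Real.sqrt_mul ht.le]
    have hw : √(1 + ζ * (1 / t)) ^ 2 = 1 + ζ * (1 / t) := Real.sq_sqrt hw0
    have hwn : 0 ≤ √(1 + ζ * (1 / t)) := Real.sqrt_nonneg _
    generalize √(1 + ζ * (1 / t)) = w at hw hwn ⊢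
    have hz : ζ = (w ^ 2 - 1) * √t ^ 2 := by
      rw [hw, Real.sq_sqrt ht.le]; field_simp; ring
    rw [hz]
    field_simp
    ring
  rw [wkb, wkb, stepRatio, e2, mul_mul_mul_comm, ← Complex.exp_add, ← Complex.ofReal_mul, hx,
    ← Real.mul_rpow ht.le hw0, ← e1]
  congr 2
  push_cast
  ring

theorem stepRatio_isBigO_one (p : ℝ) (s : ℂ) (ζ : ℝ) :
    stepRatio p s ζ =O[nhds 0] (fun _ => (1 : ℝ)) := by
  have h1 : (fun x : ℝ => x ^ 4) =O[nhds 0] (fun _ => (1 : ℝ)) :=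
    ((continuous_pow 4).tendsto 0).isBigO_one ℝ
  have h2 := isBigO_one_of_continuous (f := fun x : ℝ =>
    (1 + s * ζ * x + (s ^ 2 * ζ ^ 2 / 2 + p * ζ) * x ^ 2
        + (s ^ 3 * ζ ^ 3 / 6 - s * ζ ^ 2 / 4 + p * s * ζ ^ 2) * x ^ 3)) (by fun_prop)
  exact (((isBigO_step_expansion p s ζ).trans h1).add h2).congr_left fun x => by
    simp only [stepRatio]; ring

theorem tendsto_one_div_sqrt : Tendsto (fun n : ℕ => 1 / √(n : ℝ)) atTop (nhds 0) := by
  simp only [one_div]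
  exact tendsto_inv_atTop_zero.comp (Real.tendsto_sqrt_atTop.comp tendsto_natCast_atTop_atTop)

theorem isBigO_div_rpow_sub {c : ℕ → ℝ} {σ k l : ℝ}
    (h : (fun n : ℕ => c n - k * (n : ℝ) ^ σ * (1 + l / n))
      =O[atTop] (fun n : ℕ => (n : ℝ) ^ (σ - 2))) :
    (fun n : ℕ => c n / (n : ℝ) ^ σ - (k + k * l * (1 / √(n : ℝ)) ^ 2))
      =O[atTop] (fun n : ℕ => (1 / √(n : ℝ)) ^ 4) := by
  refine (h.mul (isBigO_refl (fun n : ℕ => ((n : ℝ) ^ σ)⁻¹) atTop)).congr' ?_ ?_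
  all_goals filter_upwards [eventually_gt_atTop 0] with n hn
  all_goals have hn' : (0 : ℝ) < n := by exact_mod_cast hn
  · have := (Real.rpow_pos_of_pos hn' σ).ne'
    rw [div_pow, Real.sq_sqrt hn'.le]
    field_simp
  · rw [← Real.rpow_neg hn'.le, ← Real.rpow_add hn', div_pow,
      show √(n : ℝ) ^ 4 = (√(n : ℝ) ^ 2) ^ 2 by ring, Real.sq_sqrt hn'.le,
      show σ - 2 + -σ = -(2 : ℕ) by push_cast; ring, Real.rpow_neg hn'.le, Real.rpow_natCast]
    simp

/-- The expansion of `c n` in terms of `n` rewritten in terms of `n + 1`: passing from `n ^ σ` to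
`(n + 1) ^ σ` lowers the coefficient of the second term by `σ`. -/
theorem isBigO_div_succ_rpow_sub {c : ℕ → ℝ} {σ l : ℝ}
    (h : (fun n : ℕ => c n / (n : ℝ) ^ σ - (1 + l * (1 / √(n : ℝ)) ^ 2))
      =O[atTop] (fun n : ℕ => (1 / √(n : ℝ)) ^ 4)) :
    (fun n : ℕ => c n / ((n : ℝ) + 1) ^ σ - (1 + (l - σ) * (1 / √((n : ℝ) + 1)) ^ 2))
      =O[atTop] (fun n : ℕ => (1 / √((n : ℝ) + 1)) ^ 4) := by
  have hs (n : ℕ) : (1 / √((n : ℝ) + 1)) ^ 2 = 1 / ((n : ℝ) + 1) := by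
    rw [div_pow, Real.sq_sqrt (by positivity), one_pow]
  have hs4 (n : ℕ) : (1 / √((n : ℝ) + 1)) ^ 4 = 1 / ((n : ℝ) + 1) ^ 2 := by
    rw [show (1 / √((n : ℝ) + 1)) ^ 4 = ((1 / √((n : ℝ) + 1)) ^ 2) ^ 2 by ring, hs]; simp
  have ht (n : ℕ) : (1 / √(n : ℝ)) ^ 2 = 1 / (n : ℝ) := by
    rw [div_pow, Real.sq_sqrt (by positivity), one_pow]
  have ht4 (n : ℕ) : (1 / √(n : ℝ)) ^ 4 = 1 / (n : ℝ) ^ 2 := by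
    rw [show (1 / √(n : ℝ)) ^ 4 = ((1 / √(n : ℝ)) ^ 2) ^ 2 by ring, ht]; simp
  simp only [hs, hs4, ht, ht4] at h ⊢
  -- expansion of `(n / (n + 1)) ^ σ`
  have hy : Tendsto (fun n : ℕ => -(1 / ((n : ℝ) + 1))) atTop (nhds 0) := by
    simpa using tendsto_one_div_add_atTop_nhds_zero_nat (𝕜 := ℝ).neg
  have hpow := (isBigO_one_add_rpow_sub σ).comp_tendsto hy
  have hnn : (fun n : ℕ => 1 / (n : ℝ) ^ 2) =O[atTop] (fun n : ℕ => 1 / ((n : ℝ) + 1) ^ 2) := by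
    refine IsBigO.of_bound 4 ?_
    filter_upwards [eventually_ge_atTop 1] with n hn
    have hn' : (1 : ℝ) ≤ n := by exact_mod_cast hn
    rw [Real.norm_of_nonneg (by positivity), Real.norm_of_nonneg (by positivity), mul_one_div,
      div_le_div_iff₀ (by positivity) (by positivity)]
    nlinarith
  have h1 : (fun n : ℕ => c n / (n : ℝ) ^ σ - (1 + l * (1 / ((n : ℝ) + 1))))
      =O[atTop] (fun n : ℕ => 1 / ((n : ℝ) + 1) ^ 2) := by
    have h2 : (fun n : ℕ => l * (1 / (n : ℝ) - 1 / ((n : ℝ) + 1)))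
        =O[atTop] (fun n : ℕ => 1 / (n : ℝ) ^ 2) := by
      refine IsBigO.const_mul_left (IsBigO.of_bound 1 ?_) _
      filter_upwards [eventually_ge_atTop 1] with n hn
      have hn' : (1 : ℝ) ≤ n := by exact_mod_cast hn
      have e : 1 / (n : ℝ) - 1 / ((n : ℝ) + 1) = 1 / (n * (n + 1)) := by field_simp; ring
      rw [e, Real.norm_of_nonneg (by positivity), Real.norm_of_nonneg (by positivity), one_mul]
      exact one_div_le_one_div_of_le (by positivity) (by nlinarith)
    exact ((h.trans hnn).add (h2.trans hnn)).congr_left fun n => by ring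
  have hp : (fun n : ℕ => (1 + -(1 / ((n : ℝ) + 1))) ^ σ - (1 + σ * -(1 / ((n : ℝ) + 1))))
      =O[atTop] (fun n : ℕ => 1 / ((n : ℝ) + 1) ^ 2) := by
    refine hpow.congr_right fun n => ?_
    simp
  have hb : Tendsto (fun n : ℕ => (1 + -(1 / ((n : ℝ) + 1))) ^ σ) atTop (nhds 1) := by
    have := (Real.continuousAt_rpow_const 1 σ (Or.inl one_ne_zero)).tendsto.comp
      (show Tendsto (fun n : ℕ => 1 + -(1 / ((n : ℝ) + 1))) atTop (nhds 1) by
        simpa using hy.const_add 1)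
    simpa [Function.comp_def] using this
  have hl : Tendsto (fun n : ℕ => 1 + l * (1 / ((n : ℝ) + 1))) atTop (nhds 1) := by
    have := ((tendsto_one_div_add_atTop_nhds_zero_nat (𝕜 := ℝ)).const_mul l).const_add 1
    simpa using this
  have h3 := h1.mul (hb.isBigO_one ℝ)
  have h4 := (hl.isBigO_one ℝ).mul hp
  have h5 : (fun n : ℕ => -(l * σ) * (1 / ((n : ℝ) + 1) ^ 2))
      =O[atTop] (fun n : ℕ => 1 / ((n : ℝ) + 1) ^ 2) := (isBigO_refl _ _).const_mul_left _
  simp only [mul_one, one_mul] at h3 h4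
  refine ((h3.add h4).add h5).congr' ?_ EventuallyEq.rfl
  filter_upwards [eventually_ge_atTop 1] with n hn
  have hn' : (0 : ℝ) < n := by exact_mod_cast hn
  have e : (1 + -(1 / ((n : ℝ) + 1))) ^ σ = (n : ℝ) ^ σ / ((n : ℝ) + 1) ^ σ := by
    rw [← Real.div_rpow hn'.le (by positivity)]
    congr 1; field_simp; ring
  rw [e]
  have := (Real.rpow_pos_of_pos hn' σ).ne'
  field_simp
  ring

/-- The Casoratian (discrete Wronskian) of two sequences, weighted by the off-diagonal Jacobi
coefficients. It is constant in `n` if both sequences solve the same Jacobi recurrence. -/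
noncomputable def casoratian (a : ℕ → ℝ) (Q A : ℕ → ℂ) (n : ℕ) : ℂ :=
  a n * (Q (n + 1) * A n - Q n * A (n + 1))

/-- The ansatz along the integers, with the exponent `1 / 4 - σ / 2` for which it nearly solves the
recurrence. -/
noncomputable def wkbSeq (σ : ℝ) (s : ℂ) (n : ℕ) : ℂ := wkb (1 / 4 - σ / 2) s n

theorem wkbSeq_ne_zero (σ : ℝ) (s : ℂ) {n : ℕ} (hn : 1 ≤ n) : wkbSeq σ s n ≠ 0 :=
  wkb_ne_zero _ _ (by exact_mod_cast hn)

/-- In the sum of the two neighbouring terms of the ansatz, the choice of `s` and of the exponent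
`1 / 4 - σ / 2` makes all terms up to the third order in `X` agree with the diagonal term. -/
theorem residual_combination {X : ℕ → ℝ} (hX : Tendsto X atTop (nhds 0)) {f₀ f₁ g : ℕ → ℝ}
    {α β σ : ℝ} {s : ℂ}
    (h₁ : (fun n => f₁ n - (1 + α * X n ^ 2)) =O[atTop] (fun n => X n ^ 4))
    (h₀ : (fun n => f₀ n - (1 + (α - σ) * X n ^ 2)) =O[atTop] (fun n => X n ^ 4))
    (hg : (fun n => g n - (2 + 2 * β * X n ^ 2)) =O[atTop] (fun n => X n ^ 4))
    (hs : s ^ 2 = ((2 * β - 2 * α + σ : ℝ) : ℂ)) :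
    (fun n => f₁ n * stepRatio (1 / 4 - σ / 2) s 1 (X n)
        + f₀ n * stepRatio (1 / 4 - σ / 2) s (-1) (X n) - g n)
      =O[atTop] (fun n => X n ^ 4) := by
  obtain ⟨p, hp⟩ : ∃ p : ℝ, p = 1 / 4 - σ / 2 := ⟨_, rfl⟩
  rw [← hp]
  have hpc : (p : ℂ) = 1 / 4 - σ / 2 := by rw [hp]; push_cast; ring
  have hs' : s ^ 2 = 2 * β - 2 * α + σ := by rw [hs]; push_cast; ring
  rw [← Complex.isBigO_ofReal_left] at h₁ h₀ hg
  have hG (ζ : ℝ) := (isBigO_step_expansion p s ζ).comp_tendsto hX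
  have hGb (ζ : ℝ) := (stepRatio_isBigO_one p s ζ).comp_tendsto hX
  simp only [Function.comp_def] at hG hGb
  have hP (k l : ℂ) : (fun n => k + l * (X n : ℂ) ^ 2) =O[atTop] (fun _ => (1 : ℝ)) :=
    (isBigO_one_of_continuous (f := fun x : ℝ => k + l * (x : ℂ) ^ 2)
      (by fun_prop)).comp_tendsto hX
  simp only [Complex.ofReal_sub, Complex.ofReal_add, Complex.ofReal_mul, Complex.ofReal_pow,
    Complex.ofReal_one, Complex.ofReal_ofNat] at h₁ h₀ hg
  have e₁ := isBigO_mul_sub_mul h₁ (hG 1) (hGb 1) (hP 1 α)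
  have e₀ := isBigO_mul_sub_mul h₀ (hG (-1)) (hGb (-1)) (hP 1 (α - σ))
  have hrest := (isBigO_continuous_mul_pow (f := fun x : ℝ =>
    ((α : ℂ) * (s ^ 2 / 2 + p) + (α - σ) * (s ^ 2 / 2 - p))
      + ((α : ℂ) * (s ^ 3 / 6 - s / 4 + p * s) + (α - σ) * (-s ^ 3 / 6 - s / 4 + p * s)) * x)
      (by fun_prop) 4).comp_tendsto hX
  simp only [Function.comp_def] at hrest
  refine (((e₁.add e₀).sub hg).add hrest).congr_left fun n => ?_
  generalize stepRatio p s 1 (X n) = G₁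
  generalize stepRatio p s (-1) (X n) = G₀
  generalize (X n : ℂ) = x
  push_cast
  -- the coefficient of `x ^ 2` vanishes as `s ^ 2 = 2 * β - 2 * α + σ`, that of `x ^ 3` as
  -- `p = 1 / 4 - σ / 2`
  linear_combination (-x ^ 2) * hs' - (2 * s * x ^ 3) * hpc

theorem tendsto_one_div_sqrt_succ :
    Tendsto (fun n : ℕ => 1 / √((n : ℝ) + 1)) atTop (nhds 0) := by
  simpa [Function.comp_def] using tendsto_one_div_sqrt.comp (tendsto_add_atTop_nat 1)

/-- The ansatz solves the recurrence up to a relative error `O(n ^ (σ - 2))`. -/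
theorem wkbSeq_residual {a B : ℕ → ℝ} {σ α β : ℝ} {s : ℂ}
    (ha : (fun n : ℕ => a n - (n : ℝ) ^ σ * (1 + α / n))
      =O[atTop] (fun n : ℕ => (n : ℝ) ^ (σ - 2)))
    (hB : (fun n : ℕ => B n - 2 * (n : ℝ) ^ σ * (1 + β / n))
      =O[atTop] (fun n : ℕ => (n : ℝ) ^ (σ - 2)))
    (hs : s ^ 2 = ((2 * β - 2 * α + σ : ℝ) : ℂ)) :
    (fun n : ℕ => (a (n + 1) * wkbSeq σ s (n + 2)
        + a n * wkbSeq σ s n) / wkbSeq σ s (n + 1) - B (n + 1))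
      =O[atTop] (fun n : ℕ => ((n : ℝ) + 1) ^ (σ - 2)) := by
  have hA := isBigO_div_rpow_sub (k := 1) (by simpa only [one_mul] using ha)
  simp only [one_mul] at hA
  have hA0 := isBigO_div_succ_rpow_sub hA
  have hA1 := hA.comp_tendsto (tendsto_add_atTop_nat 1)
  have hB1 := (isBigO_div_rpow_sub hB).comp_tendsto (tendsto_add_atTop_nat 1)
  simp only [Function.comp_def, Nat.cast_add, Nat.cast_one] at hA1 hB1
  have hcomb := residual_combination tendsto_one_div_sqrt_succ hA1 hA0 hB1 hs
  simp only [wkbSeq]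
  generalize 1 / 4 - σ / 2 = p at hcomb ⊢
  have hmul := (Complex.isBigO_ofReal_left.2
    (isBigO_refl (fun n : ℕ => ((n : ℝ) + 1) ^ σ) atTop)).mul hcomb
  refine hmul.congr' ?_ ?_
  · filter_upwards with n
    have hn1 : (0 : ℝ) < (n : ℝ) + 1 := by positivity
    have w2 := wkb_add p s hn1 (ζ := 1) (by positivity)
    have w0 := wkb_add p s hn1 (ζ := -1) (by simp)
    have hne := wkb_ne_zero p s hn1
    have hσ0 : ((((n : ℝ) + 1) ^ σ : ℝ) : ℂ) ≠ 0 := by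
      exact_mod_cast (Real.rpow_pos_of_pos hn1 σ).ne'
    rw [show (n : ℝ) + 1 + 1 = ((n + 2 : ℕ) : ℝ) by push_cast; ring] at w2
    rw [show (n : ℝ) + 1 + -1 = (n : ℝ) by ring] at w0
    rw [w2, w0, show ((n + 1 : ℕ) : ℝ) = (n : ℝ) + 1 by push_cast; ring]
    push_cast
    field_simp
  · filter_upwards with n
    have hn1 : (0 : ℝ) < (n : ℝ) + 1 := by positivity
    rw [show (1 / √((n : ℝ) + 1)) ^ 4 = 1 / (√((n : ℝ) + 1) ^ 2) ^ 2 by rw [div_pow]; ring,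
      Real.sq_sqrt hn1.le, Real.rpow_sub hn1, Real.rpow_ofNat]
    ring

/-- The Casoratian of the growing and the decaying ansatz tends to `2 * s`. -/
theorem isBigO_casoratian_wkbSeq {a : ℕ → ℝ} {σ α : ℝ} (s : ℂ)
    (ha : (fun n : ℕ => a n - (n : ℝ) ^ σ * (1 + α / n))
      =O[atTop] (fun n : ℕ => (n : ℝ) ^ (σ - 2))) :
    (fun n : ℕ => casoratian a (wkbSeq σ s) (wkbSeq σ (-s)) n - 2 * s)
      =O[atTop] (fun n : ℕ => 1 / √(n : ℝ)) := by
  simp only [casoratian, wkbSeq]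
  obtain ⟨p, hp⟩ : ∃ p : ℝ, p = 1 / 4 - σ / 2 := ⟨_, rfl⟩
  rw [← hp]
  have hX := tendsto_one_div_sqrt
  have hA := isBigO_div_rpow_sub (k := 1) (by simpa only [one_mul] using ha)
  have hG (s : ℂ) := (isBigO_step_expansion p s 1).comp_tendsto hX
  have hGb (s : ℂ) := (stepRatio_isBigO_one p s 1).comp_tendsto hX
  rw [← Complex.isBigO_ofReal_left] at hA
  simp only [Function.comp_def] at hG hGb
  simp only [Complex.ofReal_sub, Complex.ofReal_add, Complex.ofReal_mul, Complex.ofReal_pow,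
    Complex.ofReal_one, one_mul] at hA
  have hP : (fun n : ℕ => 1 + (α : ℂ) * ((1 / √(n : ℝ) : ℝ) : ℂ) ^ 2)
      =O[atTop] (fun _ => (1 : ℝ)) :=
    (isBigO_one_of_continuous (f := fun x : ℝ => 1 + (α : ℂ) * (x : ℂ) ^ 2)
      (by fun_prop)).comp_tendsto hX
  have e := isBigO_mul_sub_mul hA ((hG s).sub (hG (-s)) |>.congr_left fun n => by
    rw [sub_sub_sub_comm]) ((hGb s).sub (hGb (-s))) hP
  have hrest := (isBigO_continuous_mul_pow (f := fun x : ℝ =>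
    (2 * (s ^ 3 / 6 - s / 4 + p * s) * x
      + α * x * (2 * s + 2 * (s ^ 3 / 6 - s / 4 + p * s) * x ^ 2)))
      (by fun_prop) 2).comp_tendsto hX
  simp only [Function.comp_def] at hrest
  have h42 : (fun n : ℕ => (1 / √(n : ℝ)) ^ 4) =O[atTop] (fun n : ℕ => (1 / √(n : ℝ)) ^ 2) := by
    have := ((hX.pow 2).isBigO_one ℝ).mul (isBigO_refl (fun n : ℕ => (1 / √(n : ℝ)) ^ 2) atTop)
    exact this.congr (fun n => by ring) (fun n => by ring)
  have h := (e.trans h42).add hrest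
  have hmul := (Complex.isBigO_ofReal_left.2
    (isBigO_refl (fun n : ℕ => √(n : ℝ)) atTop)).mul h
  refine hmul.congr' ?_ ?_
  · filter_upwards [eventually_gt_atTop 0] with n hn
    have hn0 : (0 : ℝ) < n := by exact_mod_cast hn
    have w := wkb_add p s hn0 (ζ := 1) (by positivity)
    have w' := wkb_add p (-s) hn0 (ζ := 1) (by positivity)
    have hww := wkb_mul_wkb_neg p s hn0
    have hσ : (n : ℝ) ^ (2 * p) = √(n : ℝ) / (n : ℝ) ^ σ := by
      rw [Real.sqrt_eq_rpow, ← Real.rpow_sub hn0, hp]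
      congr 1; ring
    rw [show ((n + 1 : ℕ) : ℝ) = (n : ℝ) + 1 by push_cast; ring, w, w']
    have e1 : (a n : ℂ) * (wkb p s n * stepRatio p s 1 (1 / √(n : ℝ)) * wkb p (-s) n
        - wkb p s n * (wkb p (-s) n * stepRatio p (-s) 1 (1 / √(n : ℝ))))
        = a n * (wkb p s n * wkb p (-s) n) *
          (stepRatio p s 1 (1 / √(n : ℝ)) - stepRatio p (-s) 1 (1 / √(n : ℝ))) := by ring
    rw [e1, hww, hσ]
    have hn1 : (√(n : ℝ) : ℂ) ≠ 0 := by exact_mod_cast (Real.sqrt_pos.2 hn0).ne'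
    push_cast
    field_simp
    ring
  · filter_upwards [eventually_gt_atTop 0] with n hn
    have hn0 : (0 : ℝ) < n := by exact_mod_cast hn
    have := (Real.sqrt_pos.2 hn0).ne'
    field_simp

/-! ### Almost diagonal recursions -/

/-- The terms of the convergent series `∑ n ^ (-1 - ϱ)` are dominated by differences of
`n ^ (-ϱ) / ϱ`, so that sums and products over them telescope. -/
theorem mul_rpow_succ_le_sub {ϱ : ℝ} (hϱ : 0 < ϱ) {n : ℕ} (hn : 1 ≤ n) :
    ϱ * ((n : ℝ) + 1) ^ (-1 - ϱ) ≤ (n : ℝ) ^ (-ϱ) - ((n : ℝ) + 1) ^ (-ϱ) := by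
  have hn0 : (0 : ℝ) < n := by exact_mod_cast hn
  have hn1 : (0 : ℝ) < (n : ℝ) + 1 := by positivity
  have ht : 0 < (n : ℝ) / ((n : ℝ) + 1) := by positivity
  have h1 : 1 + ϱ / ((n : ℝ) + 1) ≤ ((n : ℝ) / ((n : ℝ) + 1)) ^ (-ϱ) := by
    rw [Real.rpow_def_of_pos ht]
    have hl := Real.log_le_sub_one_of_pos ht
    have e : (n : ℝ) / ((n : ℝ) + 1) - 1 = -(1 / ((n : ℝ) + 1)) := by field_simp; ring
    have : ϱ / ((n : ℝ) + 1) ≤ Real.log ((n : ℝ) / ((n : ℝ) + 1)) * -ϱ := by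
      rw [e] at hl
      have := mul_le_mul_of_nonneg_left hl hϱ.le
      rw [div_eq_mul_one_div]
      linarith
    linarith [Real.add_one_le_exp (Real.log ((n : ℝ) / ((n : ℝ) + 1)) * -ϱ)]
  rw [Real.div_rpow hn0.le hn1.le, le_div_iff₀ (Real.rpow_pos_of_pos hn1 _)] at h1
  have e2 : ((n : ℝ) + 1) ^ (-1 - ϱ) = ((n : ℝ) + 1) ^ (-ϱ) / ((n : ℝ) + 1) := by
    rw [show -1 - ϱ = -ϱ - 1 by ring, Real.rpow_sub hn1, Real.rpow_one]
  rw [e2]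
  calc _ = (1 + ϱ / ((n : ℝ) + 1)) * ((n : ℝ) + 1) ^ (-ϱ) - ((n : ℝ) + 1) ^ (-ϱ) := by ring
    _ ≤ _ := by linarith

theorem one_add_mul_rpow_succ_le_exp {ϱ L : ℝ} (hϱ : 0 < ϱ) (hL : 0 ≤ L) {n : ℕ} (hn : 1 ≤ n) :
    1 + L * ((n : ℝ) + 1) ^ (-1 - ϱ)
      ≤ Real.exp (L / ϱ * ((n : ℝ) ^ (-ϱ) - ((n : ℝ) + 1) ^ (-ϱ))) := by
  have h := mul_le_mul_of_nonneg_left (mul_rpow_succ_le_sub hϱ hn) (div_nonneg hL hϱ.le)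
  have e : L / ϱ * (ϱ * ((n : ℝ) + 1) ^ (-1 - ϱ)) = L * ((n : ℝ) + 1) ^ (-1 - ϱ) := by
    field_simp
  rw [e] at h
  linarith [Real.add_one_le_exp (L / ϱ * ((n : ℝ) ^ (-ϱ) - ((n : ℝ) + 1) ^ (-ϱ)))]

theorem exp_mul_rpow_sub_le {ϱ L : ℝ} (hϱ : 0 < ϱ) (hL : 0 ≤ L) {N n : ℕ} (hN : 1 ≤ N) :
    Real.exp (L / ϱ * ((N : ℝ) ^ (-ϱ) - (n : ℝ) ^ (-ϱ))) ≤ Real.exp (L / ϱ) := by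
  refine Real.exp_le_exp.2 (mul_le_of_le_one_right (by positivity) ?_)
  have h1 : (N : ℝ) ^ (-ϱ) ≤ 1 :=
    Real.rpow_le_one_of_one_le_of_nonpos (by exact_mod_cast hN) (by linarith)
  have h2 : (0 : ℝ) ≤ (n : ℝ) ^ (-ϱ) := by positivity
  linarith

/-- A sequence whose relative increments are at most `L * (n + 1) ^ (-1 - ϱ)` stays bounded. -/
theorem gronwall_rpow {ϱ L : ℝ} (hϱ : 0 < ϱ) (hL : 0 ≤ L) {N : ℕ} (hN : 1 ≤ N) {x : ℕ → ℝ}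
    (hx : ∀ n, 0 ≤ x n) (h : ∀ n ≥ N, x (n + 1) ≤ (1 + L * ((n : ℝ) + 1) ^ (-1 - ϱ)) * x n) :
    ∀ n ≥ N, x n ≤ Real.exp (L / ϱ) * x N := by
  have key : ∀ n ≥ N, x n ≤ Real.exp (L / ϱ * ((N : ℝ) ^ (-ϱ) - (n : ℝ) ^ (-ϱ))) * x N := by
    intro n hn
    induction n, hn using Nat.le_induction with
    | base => simp
    | succ n hn ih =>
      have h1 := one_add_mul_rpow_succ_le_exp hϱ hL (hN.trans hn)
      calc x (n + 1) ≤ (1 + L * ((n : ℝ) + 1) ^ (-1 - ϱ)) * x n := h n hn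
        _ ≤ Real.exp (L / ϱ * ((n : ℝ) ^ (-ϱ) - ((n : ℝ) + 1) ^ (-ϱ))) *
            (Real.exp (L / ϱ * ((N : ℝ) ^ (-ϱ) - (n : ℝ) ^ (-ϱ))) * x N) := by
          gcongr
          exact hx n
        _ = _ := by
          rw [← mul_assoc, ← Real.exp_add]
          push_cast
          ring_nf
  intro n hn
  exact (key n hn).trans (mul_le_mul_of_nonneg_right (exp_mul_rpow_sub_le hϱ hL hN) (hx N))

/-- A sequence whose relative decrements are at most `L * (n + 1) ^ (-1 - ϱ)` stays away from
zero. -/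
theorem gronwall_rpow_lower {ϱ L : ℝ} (hϱ : 0 < ϱ) (hL : 0 ≤ L) {N : ℕ} (hN : 1 ≤ N)
    {x : ℕ → ℝ} (hx : ∀ n, 0 ≤ x n)
    (h : ∀ n ≥ N, x n ≤ (1 + L * ((n : ℝ) + 1) ^ (-1 - ϱ)) * x (n + 1)) :
    ∀ n ≥ N, x N ≤ Real.exp (L / ϱ) * x n := by
  have key : ∀ n ≥ N, x N ≤ Real.exp (L / ϱ * ((N : ℝ) ^ (-ϱ) - (n : ℝ) ^ (-ϱ))) * x n := by
    intro n hn
    induction n, hn using Nat.le_induction with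
    | base => simp
    | succ n hn ih =>
      have h1 := one_add_mul_rpow_succ_le_exp hϱ hL (hN.trans hn)
      calc x N ≤ Real.exp (L / ϱ * ((N : ℝ) ^ (-ϱ) - (n : ℝ) ^ (-ϱ))) * x n := ih
        _ ≤ Real.exp (L / ϱ * ((N : ℝ) ^ (-ϱ) - (n : ℝ) ^ (-ϱ))) *
            (Real.exp (L / ϱ * ((n : ℝ) ^ (-ϱ) - ((n : ℝ) + 1) ^ (-ϱ))) * x (n + 1)) := by
          gcongr
          exact (h n hn).trans (mul_le_mul_of_nonneg_right h1 (hx _))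
        _ = _ := by
          rw [← mul_assoc, ← Real.exp_add]
          push_cast
          ring_nf
  intro n hn
  exact (key n hn).trans (mul_le_mul_of_nonneg_right (exp_mul_rpow_sub_le hϱ hL hN) (hx n))

theorem tendsto_natCast_rpow_neg {ϱ : ℝ} (hϱ : 0 < ϱ) :
    Tendsto (fun n : ℕ => (n : ℝ) ^ (-ϱ)) atTop (nhds 0) :=
  (tendsto_rpow_neg_atTop hϱ).comp tendsto_natCast_atTop_atTop

/-- Summable increments of size `n ^ (-1 - ϱ)` give convergence at the rate `n ^ (-ϱ)`, with an
explicit constant. -/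
theorem exists_limit_of_norm_sub_le {ϱ L : ℝ} (hϱ : 0 < ϱ) (hL : 0 ≤ L) {N : ℕ} (hN : 1 ≤ N)
    {f : ℕ → ℂ} (h : ∀ n ≥ N, ‖f (n + 1) - f n‖ ≤ L * ((n : ℝ) + 1) ^ (-1 - ϱ)) :
    ∃ l : ℂ, ∀ n ≥ N, ‖f n - l‖ ≤ L / ϱ * (n : ℝ) ^ (-ϱ) := by
  have key : ∀ n ≥ N, ∀ m ≥ n, ‖f m - f n‖ ≤ L / ϱ * ((n : ℝ) ^ (-ϱ) - (m : ℝ) ^ (-ϱ)) := by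
    intro n hn m hm
    induction m, hm using Nat.le_induction with
    | base => simp
    | succ m hm ih =>
      have h1 := mul_le_mul_of_nonneg_left (mul_rpow_succ_le_sub hϱ (hN.trans (hn.le.trans hm)))
        (div_nonneg hL hϱ.le)
      have e : L / ϱ * (ϱ * ((m : ℝ) + 1) ^ (-1 - ϱ)) = L * ((m : ℝ) + 1) ^ (-1 - ϱ) := by
        field_simp
      rw [e] at h1
      calc ‖f (m + 1) - f n‖ = ‖(f (m + 1) - f m) + (f m - f n)‖ := by ring_nf
        _ ≤ ‖f (m + 1) - f m‖ + ‖f m - f n‖ := norm_add_le _ _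
        _ ≤ _ := by
          push_cast
          linarith [h m (hn.le.trans hm)]
  have key2 : ∀ n ≥ N, ∀ m ≥ n, ‖f m - f n‖ ≤ L / ϱ * (n : ℝ) ^ (-ϱ) := by
    intro n hn m hm
    refine (key n hn m hm).trans (mul_le_mul_of_nonneg_left ?_ (div_nonneg hL hϱ.le))
    have : (0 : ℝ) ≤ (m : ℝ) ^ (-ϱ) := by positivity
    linarith
  have hc : CauchySeq fun n => f (n + N) := by
    refine cauchySeq_of_le_tendsto_0' (fun n => L / ϱ * ((n + N : ℕ) : ℝ) ^ (-ϱ)) ?_ ?_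
    · intro n m hnm
      rw [dist_comm, dist_eq_norm]
      exact key2 (n + N) (by omega) (m + N) (by omega)
    · have := ((tendsto_natCast_rpow_neg hϱ).comp (tendsto_add_atTop_nat N)).const_mul (L / ϱ)
      rwa [mul_zero] at this
  obtain ⟨l, hl⟩ := cauchySeq_tendsto_of_complete hc
  rw [tendsto_add_atTop_iff_nat] at hl
  refine ⟨l, fun n hn => ?_⟩
  rw [norm_sub_rev]
  refine le_of_tendsto ((hl.sub_const (f n)).norm) ?_
  filter_upwards [eventually_ge_atTop n] with m hm using key2 n hn m hm

theorem tendsto_of_norm_sub_le_rpow {ϱ L : ℝ} (hϱ : 0 < ϱ) {N : ℕ} {f : ℕ → ℂ} {l : ℂ}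
    (h : ∀ n ≥ N, ‖f n - l‖ ≤ L * (n : ℝ) ^ (-ϱ)) : Tendsto f atTop (nhds l) := by
  rw [tendsto_iff_norm_sub_tendsto_zero]
  have := (tendsto_natCast_rpow_neg hϱ).const_mul L
  rw [mul_zero] at this
  refine squeeze_zero' (Eventually.of_forall fun _ => norm_nonneg _) ?_ this
  filter_upwards [eventually_ge_atTop N] with n hn using h n hn

/-- Under a damping factor `1 - 3 / (n + 1)`, the sequence `M * n ^ (-ϱ)` is a supersolution of the
recursion. -/
theorem le_rpow_of_damped {ϱ L : ℝ} (hϱ1 : ϱ ≤ 1) (hL : 0 ≤ L) {N : ℕ}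
    (hN : 2 ≤ N) {y q : ℕ → ℝ} (hy : ∀ n, 0 ≤ y n) (hq0 : ∀ n, 0 ≤ q n)
    (hq : ∀ n ≥ N, q n ≤ 1 - 3 / ((n : ℝ) + 1))
    (h : ∀ n ≥ N, y (n + 1) ≤ q n * y n + L * ((n : ℝ) + 1) ^ (-1 - ϱ)) :
    ∀ n ≥ N, y n ≤ (L + y N * (N : ℝ) ^ ϱ) * (n : ℝ) ^ (-ϱ) := by
  have hN0 : (0 : ℝ) < N := by exact_mod_cast (by omega : 0 < N)
  have hM : L ≤ L + y N * (N : ℝ) ^ ϱ := le_add_of_nonneg_right (mul_nonneg (hy N) (by positivity))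
  have hMN : y N ≤ (L + y N * (N : ℝ) ^ ϱ) * (N : ℝ) ^ (-ϱ) := by
    rw [add_mul, mul_assoc, ← Real.rpow_add hN0, add_neg_cancel, Real.rpow_zero, mul_one]
    exact le_add_of_nonneg_left (by positivity)
  generalize L + y N * (N : ℝ) ^ ϱ = M at hM hMN
  have hM0 : 0 ≤ M := hL.trans hM
  intro n hn
  induction n, hn using Nat.le_induction with
  | base => exact hMN
  | succ n hn ih =>
    have hn2 : (2 : ℝ) ≤ n := by exact_mod_cast hN.trans hn
    have hn1 : (0 : ℝ) < (n : ℝ) + 1 := by positivity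
    have hP : 0 < ((n : ℝ) + 1) ^ (-ϱ) := Real.rpow_pos_of_pos hn1 _
    have e2 : ((n : ℝ) + 1) ^ (-1 - ϱ) = ((n : ℝ) + 1) ^ (-ϱ) / ((n : ℝ) + 1) := by
      rw [show -1 - ϱ = -ϱ - 1 by ring, Real.rpow_sub hn1, Real.rpow_one]
    have h2 : (n : ℝ) ^ (-ϱ) ≤ ((n : ℝ) + 1) ^ (-ϱ) * (1 + 1 / n) := by
      have e : (n : ℝ) ^ (-ϱ) = ((n : ℝ) + 1) ^ (-ϱ) * (1 + 1 / n) ^ ϱ := by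
        rw [show (1 : ℝ) + 1 / n = ((n : ℝ) + 1) / n by field_simp,
          Real.div_rpow hn1.le (by positivity), Real.rpow_neg (by positivity),
          Real.rpow_neg hn1.le]
        have := (Real.rpow_pos_of_pos hn1 ϱ).ne'
        field_simp
      rw [e]
      refine mul_le_mul_of_nonneg_left ?_ hP.le
      calc (1 + 1 / (n : ℝ)) ^ ϱ ≤ (1 + 1 / (n : ℝ)) ^ (1 : ℝ) :=
            Real.rpow_le_rpow_of_exponent_le (by simp) hϱ1
        _ = _ := Real.rpow_one _
    -- the damping absorbs both the decrease of `n ^ (-ϱ)` and the inhomogeneity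
    have h3 : (1 - 3 / ((n : ℝ) + 1)) * (1 + 1 / n) ≤ 1 - 1 / ((n : ℝ) + 1) := by
      rw [show (1 - 3 / ((n : ℝ) + 1)) * (1 + 1 / n) = (n - 2) / n by field_simp; ring,
        show 1 - 1 / ((n : ℝ) + 1) = n / (n + 1) by field_simp; ring,
        div_le_div_iff₀ (by positivity) hn1]
      nlinarith
    have hq1 := hq n hn
    have hqn : 0 ≤ 1 - 3 / ((n : ℝ) + 1) := (hq0 n).trans hq1
    calc y (n + 1) ≤ q n * y n + L * ((n : ℝ) + 1) ^ (-1 - ϱ) := h n hn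
      _ ≤ (1 - 3 / ((n : ℝ) + 1)) * (M * (((n : ℝ) + 1) ^ (-ϱ) * (1 + 1 / n)))
          + M * ((n : ℝ) + 1) ^ (-1 - ϱ) := by
        gcongr
        · exact hy n
        · exact ih.trans (mul_le_mul_of_nonneg_left h2 hM0)
      _ = M * ((n : ℝ) + 1) ^ (-ϱ) *
          ((1 - 3 / ((n : ℝ) + 1)) * (1 + 1 / n) + 1 / ((n : ℝ) + 1)) := by
        rw [e2]; ring
      _ ≤ M * ((n : ℝ) + 1) ^ (-ϱ) * 1 := by
        gcongr
        linarith
      _ = _ := by push_cast; ring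

/-- From the index `N` on, the pair `(u, v)` obeys the diagonal recursion
`u (n + 1) = u n`, `v (n + 1) = q n * v n` up to a summable error, of relative size
`L * (n + 1) ^ (-1 - ϱ)`. -/
structure AlmostDiagonal (u v q : ℕ → ℂ) (ϱ L : ℝ) (N : ℕ) : Prop where
  norm_sub_le : ∀ n ≥ N, ‖u (n + 1) - u n‖ ≤ L * ((n : ℝ) + 1) ^ (-1 - ϱ) * (‖u n‖ + ‖v n‖)
  norm_sub_mul_le :
    ∀ n ≥ N, ‖v (n + 1) - q n * v n‖ ≤ L * ((n : ℝ) + 1) ^ (-1 - ϱ) * (‖u n‖ + ‖v n‖)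

namespace AlmostDiagonal

variable {u v q : ℕ → ℂ} {ϱ L : ℝ} {N : ℕ}

theorem norm_add_norm_le (h : AlmostDiagonal u v q ϱ L N) (hϱ : 0 < ϱ) (hL : 0 ≤ L) (hN : 1 ≤ N)
    (hq : ∀ n ≥ N, ‖q n‖ ≤ 1) :
    ∀ n ≥ N, ‖u n‖ + ‖v n‖ ≤ Real.exp (2 * L / ϱ) * (‖u N‖ + ‖v N‖) := by
  refine gronwall_rpow (x := fun n => ‖u n‖ + ‖v n‖) hϱ (by positivity) hN
    (fun n => by positivity) fun n hn => ?_
  have h1 := h.1 n hn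
  have h2 := h.2 n hn
  have h3 : ‖u (n + 1)‖ ≤ ‖u (n + 1) - u n‖ + ‖u n‖ := norm_le_norm_sub_add _ _
  have h4 : ‖v (n + 1)‖ ≤ ‖v (n + 1) - q n * v n‖ + ‖q n * v n‖ := norm_le_norm_sub_add _ _
  have h5 : ‖q n * v n‖ ≤ ‖v n‖ := by
    rw [norm_mul]; exact mul_le_of_le_one_left (norm_nonneg _) (hq n hn)
  linarith

theorem exists_limit (h : AlmostDiagonal u v q ϱ L N) (hϱ : 0 < ϱ) (hL : 0 ≤ L) (hN : 1 ≤ N)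
    (hq : ∀ n ≥ N, ‖q n‖ ≤ 1) :
    ∃ l : ℂ, ∀ n ≥ N,
      ‖u n - l‖ ≤ L * (Real.exp (2 * L / ϱ) * (‖u N‖ + ‖v N‖)) / ϱ * (n : ℝ) ^ (-ϱ) := by
  refine exists_limit_of_norm_sub_le hϱ (by positivity) hN fun n hn => (h.1 n hn).trans ?_
  rw [mul_right_comm]
  gcongr
  exact h.norm_add_norm_le hϱ hL hN hq n hn

theorem norm_le_rpow (h : AlmostDiagonal u v q ϱ L N) (hϱ : 0 < ϱ) (hϱ1 : ϱ ≤ 1) (hL : 0 ≤ L)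
    (hN : 2 ≤ N) (hq : ∀ n ≥ N, ‖q n‖ ≤ 1 - 3 / ((n : ℝ) + 1)) :
    ∀ n ≥ N, ‖v n‖ ≤ (L * (Real.exp (2 * L / ϱ) * (‖u N‖ + ‖v N‖)) + ‖v N‖ * (N : ℝ) ^ ϱ)
      * (n : ℝ) ^ (-ϱ) := by
  have hq' : ∀ n ≥ N, ‖q n‖ ≤ 1 := fun n hn => (hq n hn).trans (by
    have : 0 ≤ 3 / ((n : ℝ) + 1) := by positivity
    linarith)
  refine le_rpow_of_damped (y := fun n => ‖v n‖) (q := fun n => ‖q n‖) hϱ1 (by positivity) hN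
    (fun n => norm_nonneg _) (fun n => norm_nonneg _) hq fun n hn => ?_
  have h4 : ‖v (n + 1)‖ ≤ ‖v (n + 1) - q n * v n‖ + ‖q n * v n‖ := norm_le_norm_sub_add _ _
  rw [norm_mul] at h4
  have h2 := h.2 n hn
  have h5 : L * ((n : ℝ) + 1) ^ (-1 - ϱ) * (‖u n‖ + ‖v n‖)
      ≤ L * (Real.exp (2 * L / ϱ) * (‖u N‖ + ‖v N‖)) * ((n : ℝ) + 1) ^ (-1 - ϱ) := by
    rw [mul_right_comm]
    gcongr
    exact h.norm_add_norm_le hϱ hL (by omega) hq' n hn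
  linarith

/-- If the non-decaying component `u` tends to zero, then the pair is as small as the product `E` of
the factors `q`. Once `‖v m‖ ≤ ‖u m‖` holds with `u m ≠ 0` for a large `m`, it persists and
`u` stays away from zero; hence `u` is dominated by `v`, and `v` obeys a scalar recursion. -/
theorem exists_norm_le_of_tendsto_zero (h : AlmostDiagonal u v q ϱ L N) (hϱ : 0 < ϱ)
    (hL : 0 ≤ L) {E : ℕ → ℂ} (hE : ∀ n ≥ N, E n ≠ 0) (hqE : ∀ n ≥ N, q n = E (n + 1) / E n)
    (hq : ∀ n ≥ N, ‖q n‖ ≤ 1 - 3 / ((n : ℝ) + 1)) (hq2 : ∀ n ≥ N, 1 / 2 ≤ ‖q n‖)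
    (hu : Tendsto u atTop (nhds 0)) :
    ∃ C : ℝ, ∀ᶠ n in atTop, ‖u n‖ + ‖v n‖ ≤ C * ‖E n‖ := by
  have hsmall : ∀ᶠ n : ℕ in atTop, 4 * L * ((n : ℝ) + 1) ^ (-ϱ) ≤ 1 := by
    have := (((tendsto_natCast_rpow_neg hϱ).comp (tendsto_add_atTop_nat 1)).const_mul (4 * L))
    rw [mul_zero] at this
    filter_upwards [this.eventually_le_const (show (0 : ℝ) < 1 by norm_num)] with n hn
    simpa using hn
  obtain ⟨N₁, hN₁⟩ := eventually_atTop.1 (hsmall.and (eventually_ge_atTop (N + 1)))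
  have hge : ∀ n ≥ N₁, N ≤ n := fun n hn => by have := (hN₁ n hn).2; omega
  have hN₁1 : ∀ n ≥ N₁, 1 ≤ n := fun n hn => by have := (hN₁ n hn).2; omega
  -- the size of the off-diagonal terms
  have hδ : ∀ n ≥ N₁, 4 * (L * ((n : ℝ) + 1) ^ (-1 - ϱ)) ≤ 1 / ((n : ℝ) + 1) := fun n hn => by
    have hn1 : (0 : ℝ) < (n : ℝ) + 1 := by positivity
    have h1 := (hN₁ n hn).1
    rw [show -1 - ϱ = -ϱ - 1 by ring, Real.rpow_sub hn1, Real.rpow_one]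
    calc _ = (4 * L * ((n : ℝ) + 1) ^ (-ϱ)) / ((n : ℝ) + 1) := by ring
      _ ≤ _ := by gcongr
  have hinv : ∀ n : ℕ, 1 / ((n : ℝ) + 1) ≤ 1 := fun n => by
    rw [div_le_one (by positivity)]; simp
  have hδ0 : ∀ n : ℕ, 0 ≤ L * ((n : ℝ) + 1) ^ (-1 - ϱ) := fun n => by positivity
  have hv1 : ∀ n ≥ N, ‖v (n + 1)‖ ≤ ‖q n‖ * ‖v n‖
      + L * ((n : ℝ) + 1) ^ (-1 - ϱ) * (‖u n‖ + ‖v n‖) := fun n hn => by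
    have h4 : ‖v (n + 1)‖ ≤ ‖v (n + 1) - q n * v n‖ + ‖q n * v n‖ := norm_le_norm_sub_add _ _
    rw [norm_mul] at h4
    linarith [h.2 n hn]
  have hu1 : ∀ n ≥ N, ‖u n‖ - L * ((n : ℝ) + 1) ^ (-1 - ϱ) * (‖u n‖ + ‖v n‖)
      ≤ ‖u (n + 1)‖ := fun n hn => by
    have h4 : ‖u n‖ ≤ ‖u n - u (n + 1)‖ + ‖u (n + 1)‖ := norm_le_norm_sub_add _ _
    rw [norm_sub_rev] at h4
    linarith [h.1 n hn]
  by_cases hcone : ∃ m ≥ N₁, ‖v m‖ ≤ ‖u m‖ ∧ u m ≠ 0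
  · -- the cone `‖v‖ ≤ ‖u‖` is invariant, and inside it `u` cannot tend to zero
    exfalso
    obtain ⟨m, hm, hvu, hum⟩ := hcone
    have step : ∀ n ≥ N₁, ‖v n‖ ≤ ‖u n‖ →
        (1 - 2 * (L * ((n : ℝ) + 1) ^ (-1 - ϱ))) * ‖u n‖ ≤ ‖u (n + 1)‖ := fun n hn hvn => by
      have h1 := hu1 n (hge n hn)
      have h2 := mul_le_mul_of_nonneg_left (add_le_add_right hvn ‖u n‖) (hδ0 n)
      linarith
    have hinvt : ∀ n ≥ m, ‖v n‖ ≤ ‖u n‖ := by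
      intro n hn
      induction n, hn using Nat.le_induction with
      | base => exact hvu
      | succ n hn ih =>
        have hn' : N₁ ≤ n := hm.le.trans hn
        refine le_trans ?_ (step n hn' ih)
        have h1 := hv1 n (hge n hn')
        have h2 := mul_le_mul_of_nonneg_left (add_le_add_right ih ‖u n‖) (hδ0 n)
        have h3 := mul_le_mul (hq n (hge n hn')) ih (norm_nonneg _)
          ((norm_nonneg _).trans (hq n (hge n hn')))
        have h4 : 4 * (L * ((n : ℝ) + 1) ^ (-1 - ϱ)) ≤ 3 / ((n : ℝ) + 1) :=
          (hδ n hn').trans (by gcongr; norm_num)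
        have h5 := mul_le_mul_of_nonneg_right h4 (norm_nonneg (u n))
        linarith
    have hlow := gronwall_rpow_lower (x := fun n => ‖u n‖) hϱ
      (show 0 ≤ 4 * L by positivity) (hN₁1 m hm) (fun n => norm_nonneg _) fun n hn => by
        have hn' : N₁ ≤ n := hm.le.trans hn
        have h1 := step n hn' (hinvt n hn)
        have h2 := (hδ n hn').trans (hinv n)
        have h0 := hδ0 n
        rw [mul_assoc]
        generalize L * ((n : ℝ) + 1) ^ (-1 - ϱ) = d at *
        have h3 := mul_le_mul_of_nonneg_left h1 (show 0 ≤ 1 + 4 * d by positivity)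
        refine le_trans ?_ h3
        have h4 : 0 ≤ 2 * d * (1 - 4 * d) * ‖u n‖ :=
          mul_nonneg (mul_nonneg (by positivity) (by linarith)) (norm_nonneg _)
        linarith
    have h0 : Tendsto (fun n => Real.exp (4 * L / ϱ) * ‖u n‖) atTop (nhds 0) := by
      simpa using hu.norm.const_mul (Real.exp (4 * L / ϱ))
    have : ‖u m‖ ≤ 0 := ge_of_tendsto h0 (by
      filter_upwards [eventually_ge_atTop m] with n hn using hlow n hn)
    exact hum (norm_le_zero_iff.1 this)
  · push Not at hcone
    have huv : ∀ n ≥ N₁, ‖u n‖ ≤ ‖v n‖ := fun n hn => by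
      by_contra! hlt
      have := hcone n hn hlt.le
      rw [this, norm_zero] at hlt
      exact absurd hlt (norm_nonneg _).not_gt
    have hb := gronwall_rpow (x := fun n => ‖v n‖ / ‖E n‖) hϱ
      (show 0 ≤ 4 * L by positivity) (hN₁1 N₁ le_rfl) (fun n => by positivity) fun n hn => by
        have hn' := hge n hn
        have hE0 : 0 < ‖E n‖ := norm_pos_iff.2 (hE n hn')
        have hE1 : 0 < ‖E (n + 1)‖ := norm_pos_iff.2 (hE (n + 1) (by omega))
        have h1 := hv1 n hn'
        have h2 := mul_le_mul_of_nonneg_left (add_le_add_left (huv n hn) ‖v n‖) (hδ0 n)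
        have hqn := hq2 n hn'
        have e : ‖E (n + 1)‖ = ‖q n‖ * ‖E n‖ := by
          rw [hqE n hn', norm_div]; field_simp
        have hq0 : 0 < ‖q n‖ := by linarith
        rw [e, div_le_iff₀ (by positivity)]
        rw [show (1 + 4 * L * ((n : ℝ) + 1) ^ (-1 - ϱ)) * (‖v n‖ / ‖E n‖) * (‖q n‖ * ‖E n‖)
          = ‖q n‖ * ‖v n‖ + ‖q n‖ * (4 * (L * ((n : ℝ) + 1) ^ (-1 - ϱ)) * ‖v n‖) by
            field_simp]
        have h3 := mul_le_mul_of_nonneg_right hqn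
          (show 0 ≤ 4 * (L * ((n : ℝ) + 1) ^ (-1 - ϱ)) * ‖v n‖ from
            mul_nonneg (mul_nonneg (by norm_num) (hδ0 n)) (norm_nonneg _))
        linarith
    refine ⟨2 * (Real.exp (4 * L / ϱ) * (‖v N₁‖ / ‖E N₁‖)), ?_⟩
    filter_upwards [eventually_ge_atTop N₁] with n hn
    have hE0 : 0 < ‖E n‖ := norm_pos_iff.2 (hE n (hge n hn))
    have h1 := hb n hn
    rw [div_le_iff₀ hE0] at h1
    linarith [huv n hn]

end AlmostDiagonal

/-! ### Variation of parameters -/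

/-- The Casoratian changes from `n` to `n + 1` by the mismatch of the two recurrences. -/
theorem casoratian_succ_sub {a : ℕ → ℝ} {Q A : ℕ → ℂ} {n : ℕ} {g h : ℂ}
    (hQ : a (n + 1) * Q (n + 2) + a n * Q n = g * Q (n + 1))
    (hA : a (n + 1) * A (n + 2) + a n * A n = h * A (n + 1)) :
    casoratian a Q A (n + 1) - casoratian a Q A n = (g - h) * (Q (n + 1) * A (n + 1)) := by
  simp only [casoratian]
  linear_combination A (n + 1) * hQ - Q (n + 1) * hA

theorem casoratian_swap (a : ℕ → ℝ) (Q A : ℕ → ℂ) (n : ℕ) :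
    casoratian a Q A n = -casoratian a A Q n := by
  simp only [casoratian]; ring

theorem mul_casoratian (a : ℕ → ℝ) (Q A A' : ℕ → ℂ) (n : ℕ) :
    Q n * casoratian a A A' n = casoratian a Q A' n * A n - casoratian a Q A n * A' n := by
  simp only [casoratian]; ring

theorem succ_mul_casoratian (a : ℕ → ℝ) (Q A A' : ℕ → ℂ) (n : ℕ) :
    Q (n + 1) * casoratian a A A' n
      = casoratian a Q A' n * A (n + 1) - casoratian a Q A n * A' (n + 1) := by
  simp only [casoratian]; ring

theorem wkbSeq_mul_neg (σ : ℝ) (s : ℂ) {n : ℕ} (hn : 1 ≤ n) :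
    wkbSeq σ s n * wkbSeq σ (-s) n = (((n : ℝ) ^ (1 / 2 - σ) : ℝ) : ℂ) := by
  rw [wkbSeq, wkbSeq, wkb_mul_wkb_neg _ _ (by exact_mod_cast hn)]
  congr 2; ring

/-- The quotient `wkbSeq σ (-s) n / wkbSeq σ s n` of the two ansatz sequences. -/
noncomputable def recessiveRatio (s : ℂ) (n : ℕ) : ℂ := Complex.exp (-4 * s * (√(n : ℝ) : ℝ))

theorem recessiveRatio_ne_zero (s : ℂ) (n : ℕ) : recessiveRatio s n ≠ 0 := Complex.exp_ne_zero _

theorem wkbSeq_neg (σ : ℝ) (s : ℂ) (n : ℕ) :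
    wkbSeq σ (-s) n = recessiveRatio s n * wkbSeq σ s n := by
  rw [wkbSeq, wkbSeq, wkb, wkb, recessiveRatio, mul_left_comm, ← Complex.exp_add]
  congr 2; ring

theorem norm_recessiveRatio (s : ℂ) (n : ℕ) :
    ‖recessiveRatio s n‖ = Real.exp (-4 * s.re * √(n : ℝ)) := by
  rw [recessiveRatio, Complex.norm_exp]
  congr 1
  simp [Complex.mul_re]

theorem norm_recessiveRatio_succ_div (s : ℂ) (n : ℕ) :
    ‖recessiveRatio s (n + 1) / recessiveRatio s n‖
      = Real.exp (-(4 * s.re / (√((n : ℝ) + 1) + √(n : ℝ)))) := by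
  rw [norm_div, norm_recessiveRatio, norm_recessiveRatio, ← Real.exp_sub]
  congr 1
  have h1 : √((n : ℝ) + 1) ^ 2 = (n : ℝ) + 1 := Real.sq_sqrt (by positivity)
  have h2 : √(n : ℝ) ^ 2 = n := Real.sq_sqrt (by positivity)
  have h3 : 0 < √((n : ℝ) + 1) := Real.sqrt_pos.2 (by positivity)
  have h4 : 0 ≤ √(n : ℝ) := Real.sqrt_nonneg _
  push_cast
  field_simp
  linear_combination (-s.re) * h1 + s.re * h2

theorem norm_recessiveRatio_succ_div_le_one {s : ℂ} (hs : 0 ≤ s.re) (n : ℕ) :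
    ‖recessiveRatio s (n + 1) / recessiveRatio s n‖ ≤ 1 := by
  rw [norm_recessiveRatio_succ_div]
  exact Real.exp_le_one_iff.2 (neg_nonpos.2 (by positivity))

/-- The norms of the quotients behave like `1 - 2 * s.re / √n`, so they lie below `1 - 3 / (n + 1)`
for large `n`. -/
theorem eventually_norm_recessiveRatio_succ_div {s : ℂ} (hs : 0 < s.re) :
    ∀ᶠ n : ℕ in atTop, ‖recessiveRatio s (n + 1) / recessiveRatio s n‖ ≤ 1 - 3 / ((n : ℝ) + 1) ∧
      1 / 2 ≤ ‖recessiveRatio s (n + 1) / recessiveRatio s n‖ := by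
  have hT : Tendsto (fun n : ℕ => √((n : ℝ) + 1)) atTop atTop := by
    refine Real.tendsto_sqrt_atTop.comp ?_
    exact tendsto_atTop_add_const_right _ _ tendsto_natCast_atTop_atTop
  filter_upwards [hT.eventually_ge_atTop (3 / s.re), hT.eventually_ge_atTop 6,
    hT.eventually_ge_atTop (8 * s.re)] with n h1 h2 h3
  rw [norm_recessiveRatio_succ_div]
  have hsq : √((n : ℝ) + 1) ^ 2 = (n : ℝ) + 1 := Real.sq_sqrt (by positivity)
  have hle : √(n : ℝ) ≤ √((n : ℝ) + 1) := Real.sqrt_le_sqrt (by linarith)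
  have h0 : 0 ≤ √(n : ℝ) := Real.sqrt_nonneg _
  rw [show 3 / ((n : ℝ) + 1) = 3 / √((n : ℝ) + 1) ^ 2 by rw [hsq]]
  clear hsq
  generalize √((n : ℝ) + 1) = t at *
  generalize √(n : ℝ) = w at *
  have ht : 0 < t := by linarith
  rw [div_le_iff₀ hs] at h1
  constructor
  · have hx : 2 * s.re / t ≤ 4 * s.re / (t + w) := by
      rw [div_le_div_iff₀ ht (by positivity)]
      nlinarith
    have hx0 : 0 < 1 + 2 * s.re / t := by positivity
    have h5 : Real.exp (-(4 * s.re / (t + w))) ≤ (1 + 2 * s.re / t)⁻¹ := by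
      rw [Real.exp_neg]
      refine inv_anti₀ hx0 ?_
      linarith [Real.add_one_le_exp (4 * s.re / (t + w))]
    refine h5.trans ?_
    rw [inv_le_iff_one_le_mul₀ hx0]
    have e : (1 - 3 / t ^ 2) * (1 + 2 * s.re / t)
        = 1 + (t * (s.re * t - 3) + s.re * (t ^ 2 - 6)) / t ^ 3 := by
      field_simp; ring
    rw [e]
    have : 0 ≤ (t * (s.re * t - 3) + s.re * (t ^ 2 - 6)) / t ^ 3 := by
      have h6 : 0 ≤ s.re * t - 3 := by linarith
      have h7 : 0 ≤ t ^ 2 - 6 := by nlinarith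
      positivity
    linarith
  · have h4 := Real.add_one_le_exp (-(4 * s.re / (t + w)))
    have h5 : 4 * s.re / (t + w) ≤ 1 / 2 := by
      rw [div_le_iff₀ (by positivity)]
      linarith
    linarith

/-- Variation of parameters: the coefficients of a solution `Q` with respect to the two ansatz
sequences, the second one scaled by `recessiveRatio`, change only through the mismatch between the
factors `h`, `h'` in the recurrences of the ansatz and the factor `g` in that of `Q`. -/
theorem norm_casoratian_step_le {a : ℕ → ℝ} {σ : ℝ} {s : ℂ} {Q : ℕ → ℂ} {n : ℕ} {g h h' : ℂ}
    {η : ℝ}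
    (hW : casoratian a (wkbSeq σ s) (wkbSeq σ (-s)) n ≠ 0)
    (hs : 0 ≤ s.re)
    (hQ : a (n + 1) * Q (n + 2) + a n * Q n = g * Q (n + 1))
    (hA : a (n + 1) * wkbSeq σ s (n + 2) + a n * wkbSeq σ s n = h * wkbSeq σ s (n + 1))
    (hA' : a (n + 1) * wkbSeq σ (-s) (n + 2) + a n * wkbSeq σ (-s) n
      = h' * wkbSeq σ (-s) (n + 1))
    (hη : ‖g - h‖ * ((n : ℝ) + 1) ^ (1 / 2 - σ)
      ≤ η * ‖casoratian a (wkbSeq σ s) (wkbSeq σ (-s)) n‖)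
    (hη' : ‖g - h'‖ * ((n : ℝ) + 1) ^ (1 / 2 - σ)
      ≤ η * ‖casoratian a (wkbSeq σ s) (wkbSeq σ (-s)) n‖) :
    ‖casoratian a Q (wkbSeq σ (-s)) (n + 1) - casoratian a Q (wkbSeq σ (-s)) n‖
      ≤ η * (‖casoratian a Q (wkbSeq σ (-s)) n‖
        + ‖casoratian a Q (wkbSeq σ s) n * recessiveRatio s n‖) ∧
    ‖casoratian a Q (wkbSeq σ s) (n + 1) * recessiveRatio s (n + 1)
        - recessiveRatio s (n + 1) / recessiveRatio s n *
          (casoratian a Q (wkbSeq σ s) n * recessiveRatio s n)‖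
      ≤ η * (‖casoratian a Q (wkbSeq σ (-s)) n‖
        + ‖casoratian a Q (wkbSeq σ s) n * recessiveRatio s n‖) := by
  have hq1 := norm_recessiveRatio_succ_div_le_one hs n
  have hE := recessiveRatio_ne_zero s n
  have hQW := succ_mul_casoratian a Q (wkbSeq σ s) (wkbSeq σ (-s)) n
  have hmul := wkbSeq_mul_neg σ s (n := n + 1) (by omega)
  have hneg := wkbSeq_neg σ s (n + 1)
  rw [show ((n + 1 : ℕ) : ℝ) = (n : ℝ) + 1 by push_cast; ring] at hmul
  have hm : 0 ≤ ((n : ℝ) + 1) ^ (1 / 2 - σ) := by positivity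
  -- the values of the solution times the recessive ansatz
  have hprod : Q (n + 1) * wkbSeq σ (-s) (n + 1)
      = ((((n : ℝ) + 1) ^ (1 / 2 - σ) : ℝ) : ℂ) / casoratian a (wkbSeq σ s) (wkbSeq σ (-s)) n *
        (casoratian a Q (wkbSeq σ (-s)) n - recessiveRatio s (n + 1) / recessiveRatio s n *
          (casoratian a Q (wkbSeq σ s) n * recessiveRatio s n)) := by
    rw [← hmul]
    field_simp
    rw [mul_assoc, mul_comm (wkbSeq σ (-s) (n + 1)), ← mul_assoc, hQW]
    rw [hneg]
    ring
  have hX : ‖casoratian a Q (wkbSeq σ (-s)) n - recessiveRatio s (n + 1) / recessiveRatio s n *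
      (casoratian a Q (wkbSeq σ s) n * recessiveRatio s n)‖
      ≤ ‖casoratian a Q (wkbSeq σ (-s)) n‖
        + ‖casoratian a Q (wkbSeq σ s) n * recessiveRatio s n‖ := by
    refine (norm_sub_le _ _).trans (add_le_add le_rfl ?_)
    rw [norm_mul]
    exact mul_le_of_le_one_left (norm_nonneg _) hq1
  have hW0 : 0 < ‖casoratian a (wkbSeq σ s) (wkbSeq σ (-s)) n‖ := norm_pos_iff.2 hW
  have main (k : ℂ) (hk : ‖g - k‖ * ((n : ℝ) + 1) ^ (1 / 2 - σ)
      ≤ η * ‖casoratian a (wkbSeq σ s) (wkbSeq σ (-s)) n‖) :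
      ‖(g - k) * (Q (n + 1) * wkbSeq σ (-s) (n + 1))‖
        ≤ η * (‖casoratian a Q (wkbSeq σ (-s)) n‖
          + ‖casoratian a Q (wkbSeq σ s) n * recessiveRatio s n‖) := by
    rw [hprod, ← mul_assoc, norm_mul, norm_mul, norm_div, Complex.norm_real,
      Real.norm_of_nonneg hm, ← mul_div_assoc]
    have hk' := (div_le_iff₀ hW0).2 hk
    have hη0 : 0 ≤ η := le_trans (by positivity) hk'
    exact mul_le_mul hk' hX (norm_nonneg _) hη0
  constructor
  · rw [casoratian_succ_sub hQ hA']
    exact main h' hη'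
  · have e : casoratian a Q (wkbSeq σ s) (n + 1) * recessiveRatio s (n + 1)
        - recessiveRatio s (n + 1) / recessiveRatio s n *
          (casoratian a Q (wkbSeq σ s) n * recessiveRatio s n)
        = (g - h) * (Q (n + 1) * wkbSeq σ (-s) (n + 1)) := by
      rw [hneg]
      have := casoratian_succ_sub hQ hA
      field_simp
      linear_combination recessiveRatio s (n + 1) * this
    rw [e]
    exact main h hη

/-! ### Amplitudes of solutions -/

/-- `Q` solves, for `n ≥ 1`, the Jacobi recurrence with off-diagonal coefficients `a`, diagonal
coefficients `-B` and spectral parameter `z`. -/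
def IsSolution (a B : ℕ → ℝ) (z : ℂ) (Q : ℕ → ℂ) : Prop :=
  ∀ n, a (n + 1) * Q (n + 2) + a n * Q n = (B (n + 1) + z) * Q (n + 1)

theorem exists_wkbSeq_recurrence {a B : ℕ → ℝ} {σ α β : ℝ} {s : ℂ}
    (ha : (fun n : ℕ => a n - (n : ℝ) ^ σ * (1 + α / n))
      =O[atTop] (fun n : ℕ => (n : ℝ) ^ (σ - 2)))
    (hB : (fun n : ℕ => B n - 2 * (n : ℝ) ^ σ * (1 + β / n))
      =O[atTop] (fun n : ℕ => (n : ℝ) ^ (σ - 2)))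
    (hs : s ^ 2 = ((2 * β - 2 * α + σ : ℝ) : ℂ)) :
    ∃ C : ℝ, 0 ≤ C ∧ ∀ᶠ n : ℕ in atTop, ∃ h : ℂ, ‖h - B (n + 1)‖ ≤ C * ((n : ℝ) + 1) ^ (σ - 2) ∧
      a (n + 1) * wkbSeq σ s (n + 2) + a n * wkbSeq σ s n = h * wkbSeq σ s (n + 1) := by
  obtain ⟨C, hC, h⟩ := (wkbSeq_residual ha hB hs).exists_nonneg
  refine ⟨C, hC, ?_⟩
  filter_upwards [h.bound] with n hn
  rw [Real.norm_of_nonneg (by positivity)] at hn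
  refine ⟨_, hn, ?_⟩
  exact (div_mul_cancel₀ _ (wkbSeq_ne_zero σ s (n := n + 1) (by omega))).symm

theorem exists_casoratian_wkbSeq_bound {a : ℕ → ℝ} {σ α ϱ : ℝ} {s : ℂ} (hs0 : s ≠ 0)
    (hϱ2 : ϱ ≤ 1 / 2)
    (ha : (fun n : ℕ => a n - (n : ℝ) ^ σ * (1 + α / n))
      =O[atTop] (fun n : ℕ => (n : ℝ) ^ (σ - 2))) :
    ∃ C : ℝ, 0 ≤ C ∧ ∀ᶠ n : ℕ in atTop,
      ‖s‖ ≤ ‖casoratian a (wkbSeq σ s) (wkbSeq σ (-s)) n‖ ∧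
      ‖1 / casoratian a (wkbSeq σ s) (wkbSeq σ (-s)) n - 1 / (2 * s)‖ ≤ C * (n : ℝ) ^ (-ϱ) := by
  have hO := isBigO_casoratian_wkbSeq s ha
  obtain ⟨C, hC, h⟩ := hO.exists_nonneg
  have h0 := hO.trans_tendsto tendsto_one_div_sqrt
  have hs1 : 0 < ‖s‖ := norm_pos_iff.2 hs0
  have h0' : ∀ᶠ n : ℕ in atTop,
      ‖casoratian a (wkbSeq σ s) (wkbSeq σ (-s)) n - 2 * s‖ ≤ ‖s‖ :=
    h0.norm.eventually_le_const (by rwa [norm_zero])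
  refine ⟨C / (2 * ‖s‖ ^ 2), by positivity, ?_⟩
  filter_upwards [h.bound, h0',
    eventually_ge_atTop 1] with n h1 h2 hn
  set W := casoratian a (wkbSeq σ s) (wkbSeq σ (-s)) n
  have hWs : ‖s‖ ≤ ‖W‖ := by
    have h3 : ‖2 * s‖ ≤ ‖2 * s - W‖ + ‖W‖ := norm_le_norm_sub_add _ _
    rw [norm_sub_rev, norm_mul, Complex.norm_ofNat] at h3
    linarith
  refine ⟨hWs, ?_⟩
  have hW0 : W ≠ 0 := norm_pos_iff.1 (hs1.trans_le hWs)
  have hn1 : (1 : ℝ) ≤ n := by exact_mod_cast hn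
  have hx : ‖1 / √(n : ℝ)‖ ≤ (n : ℝ) ^ (-ϱ) := by
    rw [Real.norm_of_nonneg (by positivity), Real.sqrt_eq_rpow, one_div, ← Real.rpow_neg
      (by positivity)]
    exact Real.rpow_le_rpow_of_exponent_le hn1 (by linarith)
  have e : 1 / W - 1 / (2 * s) = -(W - 2 * s) / (W * (2 * s)) := by field_simp; ring
  rw [e, norm_div, norm_neg, norm_mul, norm_mul, Complex.norm_ofNat, div_le_iff₀ (by positivity)]
  calc ‖W - 2 * s‖ ≤ C * (n : ℝ) ^ (-ϱ) := h1.trans (by gcongr)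
    _ = C / (2 * ‖s‖ ^ 2) * (n : ℝ) ^ (-ϱ) * (‖s‖ * (2 * ‖s‖)) := by field_simp
    _ ≤ _ := by gcongr

/-- The bound is uniform over all solutions, and over spectral parameters in bounded sets: the
parameter contributes `n ^ (1 / 2 - σ)` and the residual of the ansatz `n ^ (-3 / 2)`, both at most
`n ^ (-1 - ϱ)`. -/
theorem exists_almostDiagonal {a B : ℕ → ℝ} {σ α β ϱ : ℝ} {s : ℂ} (hs0 : s ≠ 0)
    (hsre : 0 ≤ s.re) (hϱ1 : ϱ ≤ σ - 3 / 2) (hϱ2 : ϱ ≤ 1 / 2)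
    (ha : (fun n : ℕ => a n - (n : ℝ) ^ σ * (1 + α / n))
      =O[atTop] (fun n : ℕ => (n : ℝ) ^ (σ - 2)))
    (hB : (fun n : ℕ => B n - 2 * (n : ℝ) ^ σ * (1 + β / n))
      =O[atTop] (fun n : ℕ => (n : ℝ) ^ (σ - 2)))
    (hs : s ^ 2 = ((2 * β - 2 * α + σ : ℝ) : ℂ)) :
    ∃ K : ℝ, 0 ≤ K ∧ ∀ᶠ N : ℕ in atTop, ∀ (z : ℂ) (Q : ℕ → ℂ), IsSolution a B z Q →
      AlmostDiagonal (casoratian a Q (wkbSeq σ (-s)))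
        (fun n => casoratian a Q (wkbSeq σ s) n * recessiveRatio s n)
        (fun n => recessiveRatio s (n + 1) / recessiveRatio s n) ϱ (K * (1 + ‖z‖)) N := by
  obtain ⟨C₁, hC₁, h₁⟩ := exists_wkbSeq_recurrence ha hB hs
  obtain ⟨C₂, hC₂, h₂⟩ := exists_wkbSeq_recurrence (s := -s) ha hB (by rw [neg_sq, hs])
  obtain ⟨_, _, hW⟩ := exists_casoratian_wkbSeq_bound hs0 hϱ2 ha
  have hs1 : 0 < ‖s‖ := norm_pos_iff.2 hs0
  refine ⟨(1 + C₁ + C₂) / ‖s‖, by positivity, ?_⟩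
  obtain ⟨N₀, hN₀⟩ := eventually_atTop.1 (h₁.and (h₂.and hW))
  filter_upwards [eventually_ge_atTop N₀] with N hN z Q hQ
  have main : ∀ n ≥ N, ∀ (C : ℝ) (h : ℂ), 0 ≤ C → C ≤ C₁ + C₂ →
      ‖h - B (n + 1)‖ ≤ C * ((n : ℝ) + 1) ^ (σ - 2) →
      ‖(B (n + 1) + z) - h‖ * ((n : ℝ) + 1) ^ (1 / 2 - σ)
        ≤ (1 + C₁ + C₂) / ‖s‖ * (1 + ‖z‖) * ((n : ℝ) + 1) ^ (-1 - ϱ) *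
          ‖casoratian a (wkbSeq σ s) (wkbSeq σ (-s)) n‖ := by
    intro n hn C h hC hCC hh
    have hn1 : (0 : ℝ) < (n : ℝ) + 1 := by positivity
    have hn1' : (1 : ℝ) ≤ (n : ℝ) + 1 := by simp
    have h1 : ‖(B (n + 1) + z) - h‖ ≤ ‖z‖ + C * ((n : ℝ) + 1) ^ (σ - 2) := by
      calc _ = ‖z - (h - B (n + 1))‖ := by ring_nf
        _ ≤ _ := (norm_sub_le _ _).trans (add_le_add le_rfl hh)
    have h2 : ((n : ℝ) + 1) ^ (1 / 2 - σ) ≤ ((n : ℝ) + 1) ^ (-1 - ϱ) :=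
      Real.rpow_le_rpow_of_exponent_le hn1' (by linarith)
    have h3 : ((n : ℝ) + 1) ^ (σ - 2) * ((n : ℝ) + 1) ^ (1 / 2 - σ)
        ≤ ((n : ℝ) + 1) ^ (-1 - ϱ) := by
      rw [← Real.rpow_add hn1]
      exact Real.rpow_le_rpow_of_exponent_le hn1' (by linarith)
    have hWn := (hN₀ n (hN.trans hn)).2.2.1
    have hδ : 0 ≤ ((n : ℝ) + 1) ^ (-1 - ϱ) := by positivity
    calc _ ≤ (‖z‖ + C * ((n : ℝ) + 1) ^ (σ - 2)) * ((n : ℝ) + 1) ^ (1 / 2 - σ) := by gcongr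
      _ = ‖z‖ * ((n : ℝ) + 1) ^ (1 / 2 - σ)
          + C * (((n : ℝ) + 1) ^ (σ - 2) * ((n : ℝ) + 1) ^ (1 / 2 - σ)) := by ring
      _ ≤ ‖z‖ * ((n : ℝ) + 1) ^ (-1 - ϱ) + C * ((n : ℝ) + 1) ^ (-1 - ϱ) := by gcongr
      _ = (‖z‖ + C) * ((n : ℝ) + 1) ^ (-1 - ϱ) := by ring
      _ ≤ ((1 + C₁ + C₂) * (1 + ‖z‖)) * ((n : ℝ) + 1) ^ (-1 - ϱ) := by
        gcongr
        nlinarith [norm_nonneg z]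
      _ = (1 + C₁ + C₂) / ‖s‖ * (1 + ‖z‖) * ((n : ℝ) + 1) ^ (-1 - ϱ) * ‖s‖ := by field_simp
      _ ≤ _ := by gcongr
  refine ⟨fun n hn => ?_, fun n hn => ?_⟩
  all_goals
    obtain ⟨⟨h, hh, hA⟩, ⟨h', hh', hA'⟩, hWn, -⟩ := hN₀ n (hN.trans hn)
    have step := norm_casoratian_step_le (norm_pos_iff.1 (hs1.trans_le hWn)) hsre (hQ n) hA hA'
      (main n hn C₁ h hC₁ (by linarith) hh) (main n hn C₂ h' hC₂ (by linarith) hh')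
  · exact step.1
  · exact step.2

/-- The coefficient of `wkbSeq σ s` in the solution `Q` at `n`, when the pair `(Q n, Q (n + 1))` is
written as a combination of the corresponding pairs for `wkbSeq σ s` and `wkbSeq σ (-s)`. -/
noncomputable def amplitude (a : ℕ → ℝ) (σ : ℝ) (s : ℂ) (Q : ℕ → ℂ) (n : ℕ) : ℂ :=
  casoratian a Q (wkbSeq σ (-s)) n / casoratian a (wkbSeq σ s) (wkbSeq σ (-s)) n

theorem eq_amplitude_mul_add {a : ℕ → ℝ} {σ : ℝ} {s : ℂ} (Q : ℕ → ℂ) {n : ℕ}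
    (hW : casoratian a (wkbSeq σ s) (wkbSeq σ (-s)) n ≠ 0) :
    Q n = amplitude a σ s Q n * wkbSeq σ s n + amplitude a σ (-s) Q n * wkbSeq σ (-s) n := by
  have h := mul_casoratian a Q (wkbSeq σ s) (wkbSeq σ (-s)) n
  rw [amplitude, amplitude, neg_neg, casoratian_swap a (wkbSeq σ (-s))]
  field_simp
  linear_combination h

/-- The amplitude of a non-decaying ansatz converges at the rate `n ^ (-ϱ)`; for a continuous family
of solutions the constant depends continuously on the parameter. -/
theorem exists_amplitude_limit {a B : ℕ → ℝ} {σ α β ϱ : ℝ} {s : ℂ} (hs0 : s ≠ 0)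
    (hsre : 0 ≤ s.re) (hϱ : 0 < ϱ) (hϱ1 : ϱ ≤ σ - 3 / 2) (hϱ2 : ϱ ≤ 1 / 2)
    (ha : (fun n : ℕ => a n - (n : ℝ) ^ σ * (1 + α / n))
      =O[atTop] (fun n : ℕ => (n : ℝ) ^ (σ - 2)))
    (hB : (fun n : ℕ => B n - 2 * (n : ℝ) ^ σ * (1 + β / n))
      =O[atTop] (fun n : ℕ => (n : ℝ) ^ (σ - 2)))
    (hs : s ^ 2 = ((2 * β - 2 * α + σ : ℝ) : ℂ)) {Q : ℂ → ℕ → ℂ} {ζ : ℂ → ℂ}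
    (hQ : ∀ z, IsSolution a B (ζ z) (Q z)) (hζ : Continuous ζ)
    (hQc : ∀ n, Continuous fun z => Q z n) :
    ∃ (κ : ℂ → ℂ) (M : ℂ → ℝ), Continuous M ∧ ∀ᶠ n : ℕ in atTop, ∀ z,
      ‖amplitude a σ s (Q z) n - κ z‖ ≤ M z * (n : ℝ) ^ (-ϱ) := by
  obtain ⟨K, hK, hD⟩ := exists_almostDiagonal hs0 hsre hϱ1 hϱ2 ha hB hs
  obtain ⟨C, hC, hW⟩ := exists_casoratian_wkbSeq_bound hs0 hϱ2 ha
  obtain ⟨N, hDN, hN1⟩ := (hD.and (eventually_ge_atTop 1)).exists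
  have hs1 : 0 < ‖s‖ := norm_pos_iff.2 hs0
  have hcas (A : ℕ → ℂ) : Continuous fun z => casoratian a (Q z) A N := by
    unfold casoratian
    have := hQc N
    have := hQc (N + 1)
    fun_prop
  have key (z : ℂ) := (hDN (ζ z) (Q z) (hQ z)).exists_limit hϱ
    (show 0 ≤ K * (1 + ‖ζ z‖) by positivity) hN1
    (fun n _ => norm_recessiveRatio_succ_div_le_one hsre n)
  choose l hl using key
  set G : ℂ → ℝ := fun z => K * (1 + ‖ζ z‖) * (Real.exp (2 * (K * (1 + ‖ζ z‖)) / ϱ) *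
    (‖casoratian a (Q z) (wkbSeq σ (-s)) N‖
      + ‖casoratian a (Q z) (wkbSeq σ s) N * recessiveRatio s N‖)) / ϱ with hG
  have hGc : Continuous G := by
    have h1 := hcas (wkbSeq σ (-s))
    have h2 := hcas (wkbSeq σ s)
    fun_prop
  have hG0 (z : ℂ) : 0 ≤ G z := by positivity
  have hl0 (z : ℂ) : ‖l z‖ ≤ ‖casoratian a (Q z) (wkbSeq σ (-s)) N‖ + G z := by
    have h1 := hl z N le_rfl
    have h2 : (N : ℝ) ^ (-ϱ) ≤ 1 :=
      Real.rpow_le_one_of_one_le_of_nonpos (by exact_mod_cast hN1) (by linarith)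
    have h3 := h1.trans (mul_le_of_le_one_right (hG0 z) h2)
    have h4 : ‖l z‖ ≤ ‖l z - casoratian a (Q z) (wkbSeq σ (-s)) N‖
        + ‖casoratian a (Q z) (wkbSeq σ (-s)) N‖ := norm_le_norm_sub_add _ _
    rw [norm_sub_rev] at h4
    linarith
  refine ⟨fun z => l z / (2 * s),
    fun z => G z / ‖s‖ + (‖casoratian a (Q z) (wkbSeq σ (-s)) N‖ + G z) * C, ?_, ?_⟩
  · have h1 := hcas (wkbSeq σ (-s))
    fun_prop
  · filter_upwards [hW, eventually_ge_atTop N] with n hn hnN z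
    have h1 := hl z n hnN
    set W := casoratian a (wkbSeq σ s) (wkbSeq σ (-s)) n
    have hW0 : W ≠ 0 := norm_pos_iff.1 (hs1.trans_le hn.1)
    have e : amplitude a σ s (Q z) n - l z / (2 * s)
        = (casoratian a (Q z) (wkbSeq σ (-s)) n - l z) / W + l z * (1 / W - 1 / (2 * s)) := by
      rw [amplitude]; ring
    have hr : 0 ≤ (n : ℝ) ^ (-ϱ) := by positivity
    calc _ ≤ ‖casoratian a (Q z) (wkbSeq σ (-s)) n - l z‖ / ‖W‖
          + ‖l z‖ * ‖1 / W - 1 / (2 * s)‖ := by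
          rw [e, ← norm_div, ← norm_mul]; exact norm_add_le _ _
      _ ≤ G z * (n : ℝ) ^ (-ϱ) / ‖s‖
          + (‖casoratian a (Q z) (wkbSeq σ (-s)) N‖ + G z) * (C * (n : ℝ) ^ (-ϱ)) := by
        have := hG0 z
        gcongr
        · exact hn.1
        · exact hl0 z
        · exact hn.2
      _ = _ := by ring

/-- The decaying part of a solution is of relative size `n ^ (-ϱ)` against the growing ansatz. The
amplitude itself may be unbounded. -/
theorem exists_amplitude_neg_bound {a B : ℕ → ℝ} {σ α β ϱ : ℝ} {s : ℂ}
    (hsre : 0 < s.re) (hϱ : 0 < ϱ) (hϱ1 : ϱ ≤ σ - 3 / 2) (hϱ2 : ϱ ≤ 1 / 2)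
    (ha : (fun n : ℕ => a n - (n : ℝ) ^ σ * (1 + α / n))
      =O[atTop] (fun n : ℕ => (n : ℝ) ^ (σ - 2)))
    (hB : (fun n : ℕ => B n - 2 * (n : ℝ) ^ σ * (1 + β / n))
      =O[atTop] (fun n : ℕ => (n : ℝ) ^ (σ - 2)))
    (hs : s ^ 2 = ((2 * β - 2 * α + σ : ℝ) : ℂ)) {Q : ℂ → ℕ → ℂ} {ζ : ℂ → ℂ}
    (hQ : ∀ z, IsSolution a B (ζ z) (Q z)) (hζ : Continuous ζ)
    (hQc : ∀ n, Continuous fun z => Q z n) :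
    ∃ M : ℂ → ℝ, Continuous M ∧ ∀ᶠ n : ℕ in atTop, ∀ z,
      ‖amplitude a σ (-s) (Q z) n * recessiveRatio s n‖ ≤ M z * (n : ℝ) ^ (-ϱ) := by
  have hs0 : s ≠ 0 := by rintro rfl; simp at hsre
  obtain ⟨K, hK, hD⟩ := exists_almostDiagonal hs0 hsre.le hϱ1 hϱ2 ha hB hs
  obtain ⟨C, hC, hW⟩ := exists_casoratian_wkbSeq_bound hs0 hϱ2 ha
  obtain ⟨N₀, hq⟩ := eventually_atTop.1 (eventually_norm_recessiveRatio_succ_div hsre)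
  obtain ⟨N, hDN, hN1⟩ := (hD.and (eventually_ge_atTop (N₀ + 2))).exists
  have hs1 : 0 < ‖s‖ := norm_pos_iff.2 hs0
  have hcas (A : ℕ → ℂ) : Continuous fun z => casoratian a (Q z) A N := by
    unfold casoratian
    have := hQc N
    have := hQc (N + 1)
    fun_prop
  have key (z : ℂ) := (hDN (ζ z) (Q z) (hQ z)).norm_le_rpow hϱ (by linarith)
    (show 0 ≤ K * (1 + ‖ζ z‖) by positivity) (by omega)
    (fun n hn => (hq n (by omega)).1)
  set G : ℂ → ℝ := fun z => K * (1 + ‖ζ z‖) * (Real.exp (2 * (K * (1 + ‖ζ z‖)) / ϱ) *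
    (‖casoratian a (Q z) (wkbSeq σ (-s)) N‖
      + ‖casoratian a (Q z) (wkbSeq σ s) N * recessiveRatio s N‖))
    + ‖casoratian a (Q z) (wkbSeq σ s) N * recessiveRatio s N‖ * (N : ℝ) ^ ϱ with hG
  have hGc : Continuous G := by
    have h1 := hcas (wkbSeq σ (-s))
    have h2 := hcas (wkbSeq σ s)
    fun_prop
  refine ⟨fun z => G z / ‖s‖, by fun_prop, ?_⟩
  filter_upwards [hW, eventually_ge_atTop N] with n hn hnN z
  have h1 := key z n hnN
  have hG0 : 0 ≤ G z := by positivity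
  rw [amplitude, neg_neg, casoratian_swap a (wkbSeq σ (-s)), div_mul_eq_mul_div, norm_div,
    norm_neg]
  calc _ ≤ G z * (n : ℝ) ^ (-ϱ) / ‖s‖ := by
        gcongr
        exact hn.1
    _ = _ := by ring

/-- A solution without growing part is recessive. -/
theorem isBigO_wkbSeq_neg_of_amplitude_tendsto_zero {a B : ℕ → ℝ} {σ α β ϱ : ℝ} {s : ℂ}
    (hsre : 0 < s.re) (hϱ : 0 < ϱ) (hϱ1 : ϱ ≤ σ - 3 / 2) (hϱ2 : ϱ ≤ 1 / 2)
    (ha : (fun n : ℕ => a n - (n : ℝ) ^ σ * (1 + α / n))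
      =O[atTop] (fun n : ℕ => (n : ℝ) ^ (σ - 2)))
    (hB : (fun n : ℕ => B n - 2 * (n : ℝ) ^ σ * (1 + β / n))
      =O[atTop] (fun n : ℕ => (n : ℝ) ^ (σ - 2)))
    (hs : s ^ 2 = ((2 * β - 2 * α + σ : ℝ) : ℂ)) {Q : ℕ → ℂ} {z : ℂ}
    (hQ : IsSolution a B z Q) (h0 : Tendsto (amplitude a σ s Q) atTop (nhds 0)) :
    Q =O[atTop] (wkbSeq σ (-s)) := by
  have hs0 : s ≠ 0 := by rintro rfl; simp at hsre
  obtain ⟨K, hK, hD⟩ := exists_almostDiagonal hs0 hsre.le hϱ1 hϱ2 ha hB hs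
  obtain ⟨C, hC, hW⟩ := exists_casoratian_wkbSeq_bound hs0 hϱ2 ha
  obtain ⟨N₀, hq⟩ := eventually_atTop.1 (eventually_norm_recessiveRatio_succ_div hsre)
  obtain ⟨N, hDN, hN1⟩ := (hD.and (eventually_ge_atTop (N₀ + 2))).exists
  have hs1 : 0 < ‖s‖ := norm_pos_iff.2 hs0
  have hW1 : Tendsto (casoratian a (wkbSeq σ s) (wkbSeq σ (-s))) atTop (nhds (2 * s)) := by
    have := ((isBigO_casoratian_wkbSeq s ha).trans_tendsto tendsto_one_div_sqrt).add_const (2 * s)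
    simpa using this
  have hu : Tendsto (casoratian a Q (wkbSeq σ (-s))) atTop (nhds 0) := by
    have := h0.mul hW1
    rw [zero_mul] at this
    refine this.congr' ?_
    filter_upwards [hW] with n hn
    exact div_mul_cancel₀ _ (norm_pos_iff.1 (hs1.trans_le hn.1))
  obtain ⟨C', hC'⟩ := (hDN z Q hQ).exists_norm_le_of_tendsto_zero hϱ
    (show 0 ≤ K * (1 + ‖z‖) by positivity) (E := recessiveRatio s)
    (fun n _ => recessiveRatio_ne_zero s n) (fun _ _ => rfl) (fun n hn => (hq n (by omega)).1)
    (fun n hn => (hq n (by omega)).2) hu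
  refine IsBigO.of_bound (C' / ‖s‖) ?_
  filter_upwards [hC', hW] with n h1 h2
  have hW0 : 0 < ‖casoratian a (wkbSeq σ s) (wkbSeq σ (-s)) n‖ := hs1.trans_le h2.1
  have h3 := mul_casoratian a Q (wkbSeq σ s) (wkbSeq σ (-s)) n
  have h4 : Q n = (casoratian a Q (wkbSeq σ (-s)) n
      - casoratian a Q (wkbSeq σ s) n * recessiveRatio s n) * wkbSeq σ s n
      / casoratian a (wkbSeq σ s) (wkbSeq σ (-s)) n := by
    rw [eq_div_iff (norm_pos_iff.1 hW0), h3, wkbSeq_neg]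
    ring
  have h5 : 0 ≤ C' * ‖recessiveRatio s n‖ := le_trans (by positivity) h1
  rw [h4, norm_div, norm_mul, wkbSeq_neg, norm_mul]
  calc _ ≤ C' * ‖recessiveRatio s n‖ * ‖wkbSeq σ s n‖ / ‖s‖ := by
        gcongr
        · exact (norm_sub_le _ _).trans h1
        · exact h2.1
    _ = _ := by ring

/-! ### Orthogonal polynomials -/

theorem norm_wkbSeq_ofReal (σ r : ℝ) (n : ℕ) :
    ‖wkbSeq σ r n‖ = (n : ℝ) ^ (1 / 4 - σ / 2) * Real.exp (2 * r * √(n : ℝ)) := by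
  rw [wkbSeq, wkb, norm_mul, Complex.norm_real, Real.norm_of_nonneg (by positivity),
    Complex.norm_exp]
  congr 2
  simp [Complex.mul_re]

theorem tendsto_norm_wkbSeq_atTop (σ : ℝ) {r : ℝ} (hr : 0 < r) :
    Tendsto (fun n => ‖wkbSeq σ r n‖) atTop atTop := by
  have h := (tendsto_exp_mul_div_rpow_atTop (-(1 / 2 - σ)) (2 * r) (by positivity)).comp
    (Real.tendsto_sqrt_atTop.comp tendsto_natCast_atTop_atTop)
  refine h.congr fun n => ?_
  rw [norm_wkbSeq_ofReal]
  simp only [Function.comp]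
  rw [Real.rpow_neg (Real.sqrt_nonneg _), div_inv_eq_mul, mul_comm, Real.sqrt_eq_rpow,
    ← Real.rpow_mul (by positivity)]
  congr 2; ring

/-- The decaying ansatz is `n ^ (1 / 2 - σ)` over the growing one, which is at least `1`
eventually; already `n ^ (1 / 2 - σ)` is square summable. -/
theorem summable_norm_sq_of_isBigO_wkbSeq {σ r : ℝ} (hσ : 3 / 2 < σ) (hr : 0 < r) {Q : ℕ → ℂ}
    (hQ : Q =O[atTop] (wkbSeq σ (-(r : ℂ)))) : Summable fun n => ‖Q n‖ ^ 2 := by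
  have h1 : (wkbSeq σ (-(r : ℂ))) =O[atTop] (fun n : ℕ => (n : ℝ) ^ (1 / 2 - σ)) := by
    refine IsBigO.of_bound 1 ?_
    filter_upwards [(tendsto_norm_wkbSeq_atTop σ hr).eventually_ge_atTop 1,
      eventually_ge_atTop 1] with n h2 hn
    have h3 := congrArg norm (wkbSeq_mul_neg σ r hn)
    rw [norm_mul, Complex.norm_real] at h3
    rw [one_mul, ← h3]
    exact le_mul_of_one_le_left (norm_nonneg _) h2
  have h2 := (hQ.trans h1).norm_left.pow 2
  refine summable_of_isBigO_nat (g := fun n : ℕ => (n : ℝ) ^ (2 * (1 / 2 - σ)))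
    (Real.summable_nat_rpow.2 (by linarith)) (h2.congr_right fun n => ?_)
  rw [← Real.rpow_natCast, ← Real.rpow_mul (by positivity)]
  congr 1; push_cast; ring

theorem uniformBigOOnCompacts_of_continuous_bound {ε : ℕ → ℂ → ℂ} {ϱ : ℝ} {M : ℂ → ℝ}
    (hM : Continuous M) (h : ∀ᶠ n : ℕ in atTop, ∀ z, ‖ε n z‖ ≤ M z * (n : ℝ) ^ (-ϱ)) :
    UniformBigOOnCompacts ε ϱ Set.univ := by
  intro K _ hK
  obtain ⟨C, hC⟩ := hK.exists_bound_of_continuousOn hM.continuousOn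
  refine ⟨C, h.mono fun n hn z hz => (hn z).trans ?_⟩
  gcongr
  exact (le_abs_self _).trans (hC z hz)

theorem UniformBigOOnCompacts.tendstoUniformlyOn {ε : ℕ → ℂ → ℂ} {ϱ : ℝ} (hϱ : 0 < ϱ)
    {U K : Set ℂ} (h : UniformBigOOnCompacts ε ϱ U) (hKU : K ⊆ U) (hK : IsCompact K) (κ : ℂ → ℂ) :
    TendstoUniformlyOn (fun n z => κ z + ε n z) κ atTop K := by
  obtain ⟨C, hC⟩ := h K hKU hK
  have h0 := (tendsto_natCast_rpow_neg hϱ).const_mul C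
  rw [mul_zero] at h0
  rw [Metric.tendstoUniformlyOn_iff]
  intro δ hδ
  filter_upwards [hC, h0.eventually_lt_const hδ] with n h1 h2 z hz
  rw [dist_comm, dist_eq_norm, add_sub_cancel_left]
  exact (h1 z hz).trans_lt h2

/-- The limit `κ` is continuous, so `1 / κ` is bounded on compact subsets of `{z | κ z ≠ 0}`. -/
theorem UniformBigOOnCompacts.div_limit {ε : ℕ → ℂ → ℂ} {ϱ : ℝ} (hϱ : 0 < ϱ) {κ : ℂ → ℂ}
    (h : UniformBigOOnCompacts ε ϱ Set.univ)
    (hc : ∀ᶠ n in atTop, Continuous fun z => κ z + ε n z) :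
    UniformBigOOnCompacts (fun n z => ε n z / κ z) ϱ {z | κ z ≠ 0} := by
  intro K hKU hK
  have hκ : ContinuousOn κ K :=
    (h.tendstoUniformlyOn hϱ (Set.subset_univ K) hK κ).continuousOn
      (hc.mono fun n hn => hn.continuousOn).frequently
  obtain ⟨C, hC⟩ := h K (Set.subset_univ K) hK
  obtain ⟨D, hD⟩ := hK.exists_bound_of_continuousOn (hκ.inv₀ fun z hz => hKU hz)
  refine ⟨C * D, hC.mono fun n hn z hz => ?_⟩
  change ‖ε n z / κ z‖ ≤ _
  rw [div_eq_mul_inv, norm_mul]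
  calc _ ≤ (C * (n : ℝ) ^ (-ϱ)) * D :=
        mul_le_mul (hn z hz) (hD z hz) (norm_nonneg _) ((norm_nonneg _).trans (hn z hz))
    _ = _ := by ring

theorem continuous_orthPolyAt (a b : ℕ → ℝ) (n : ℕ) : Continuous (orthPolyAt a b n) :=
  Polynomial.continuous_aeval _

/-- Multiplication by `ν ^ n` with `ν = ±1` turns the diagonal coefficients `b n` into
`ν * b n` and the spectral parameter `z` into `ν * z`. For `ν = -γ` the coefficients `-ν * b n` are
asymptotic to `2 * a n`. -/
theorem isSolution_orthPolyAt {a b : ℕ → ℝ} (ha : ∀ n, 0 < a n) {ν : ℝ} (hν : ν ^ 2 = 1) (z : ℂ) :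
    IsSolution a (fun n => -ν * b n) (ν * z) (fun n => (ν : ℂ) ^ n * orthPolyAt a b n z) := by
  intro n
  have h := orthPolyAt_recurrence_succ a b ha n z
  have hν' : (ν : ℂ) ^ 2 = 1 := by exact_mod_cast hν
  have hν2 : (ν : ℂ) ^ (n + 2) = (ν : ℂ) ^ n := by rw [pow_add, hν', mul_one]
  push_cast
  rw [hν2, pow_succ]
  linear_combination (ν : ℂ) ^ n * h
    + (ν : ℂ) ^ n * (b (n + 1) - z) * orthPolyAt a b (n + 1) z * hν'

theorem theorem2p2 (a b : ℕ → ℝ) (σ α β γ : ℝ)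
    (ha : ∀ n, 0 < a n)
    (hσ : 3 / 2 < σ)
    (hγ : |γ| = 1)
    (ha_asymp : (fun n : ℕ => a n - (n : ℝ) ^ σ * (1 + α / n))
      =O[atTop] (fun n : ℕ => (n : ℝ) ^ (σ - 2)))
    (hb_asymp : (fun n : ℕ => b n - 2 * γ * (n : ℝ) ^ σ * (1 + β / n))
      =O[atTop] (fun n : ℕ => (n : ℝ) ^ (σ - 2)))
    (ν τ ϱ : ℝ)
    (hν : ν = -Real.sign γ)
    (hτ : τ = 2 * β - 2 * α + σ)
    (hϱ : ϱ = min (σ - 3 / 2) (1 / 2)) :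
    (τ < 0 →
      ∃ (κp κm : ℂ → ℂ) (ε : ℕ → ℂ → ℂ),
        UniformBigOOnCompacts ε ϱ Set.univ ∧
        ∀ n : ℕ, 1 ≤ n → ∀ z : ℂ,
          orthPolyAt a b n z =
            (ν : ℂ) ^ n * (((n : ℝ) ^ (-σ / 2 + 1 / 4) : ℝ) : ℂ) *
              (κp z * Complex.exp (-2 * Complex.I * (Real.sqrt (|τ| * n) : ℂ))
                + κm z * Complex.exp (2 * Complex.I * (Real.sqrt (|τ| * n) : ℂ))
                + ε n z)) ∧
    (0 < τ →
      ∃ κ : ℂ → ℂ,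
        (∃ ε : ℕ → ℂ → ℂ,
          UniformBigOOnCompacts ε ϱ Set.univ ∧
          ∀ n : ℕ, 1 ≤ n → ∀ z : ℂ,
            orthPolyAt a b n z =
              (ν : ℂ) ^ n * (((n : ℝ) ^ (-σ / 2 + 1 / 4) : ℝ) : ℂ) *
                (Real.exp (2 * Real.sqrt (τ * n)) : ℂ) * (κ z + ε n z)) ∧
        (∃ ε : ℕ → ℂ → ℂ,
          UniformBigOOnCompacts ε ϱ {z | κ z ≠ 0} ∧
          ∀ n : ℕ, 1 ≤ n → ∀ z : ℂ, κ z ≠ 0 →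
            orthPolyAt a b n z =
              κ z * (ν : ℂ) ^ n * (((n : ℝ) ^ (-σ / 2 + 1 / 4) : ℝ) : ℂ) *
                (Real.exp (2 * Real.sqrt (τ * n)) : ℂ) * (1 + ε n z)) ∧
        (∀ z : ℂ, κ z = 0 ↔ Summable (fun n : ℕ => ‖orthPolyAt a b n z‖ ^ 2))) := by
  have hϱ0 : 0 < ϱ := by rw [hϱ]; exact lt_min (by linarith) (by norm_num)
  have hϱ1 : ϱ ≤ σ - 3 / 2 := hϱ ▸ min_le_left _ _
  have hϱ2 : ϱ ≤ 1 / 2 := hϱ ▸ min_le_right _ _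
  have hνγ : ν = -γ := by
    rw [hν]
    rcases eq_or_eq_neg_of_abs_eq hγ with h | h <;> simp [h, Real.sign_of_neg]
  have hγ2 : γ ^ 2 = 1 := by rw [← sq_abs, hγ, one_pow]
  have hν2 : ν ^ 2 = 1 := by rw [hνγ, neg_sq, hγ2]
  have hν2' (n : ℕ) : (ν : ℂ) ^ n * (ν : ℂ) ^ n = 1 := by
    rw [← mul_pow, ← sq, show (ν : ℂ) ^ 2 = 1 by exact_mod_cast hν2, one_pow]
  have hνn (n : ℕ) : ‖(ν : ℂ) ^ n‖ = 1 := by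
    rw [norm_pow, Complex.norm_real, hνγ, norm_neg, Real.norm_eq_abs, hγ, one_pow]
  have hB : (fun n : ℕ => -ν * b n - 2 * (n : ℝ) ^ σ * (1 + β / n))
      =O[atTop] (fun n : ℕ => (n : ℝ) ^ (σ - 2)) := by
    refine (hb_asymp.const_mul_left γ).congr_left fun n => ?_
    rw [hνγ]
    linear_combination (-2 * (n : ℝ) ^ σ * (1 + β / n)) * hγ2
  set Q : ℂ → ℕ → ℂ := fun z n => (ν : ℂ) ^ n * orthPolyAt a b n z with hQdef
  have hQ (z : ℂ) : IsSolution a (fun n => -ν * b n) (ν * z) (Q z) :=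
    isSolution_orthPolyAt ha hν2 z
  have hζ : Continuous fun z : ℂ => (ν : ℂ) * z := by fun_prop
  have hQc (n : ℕ) : Continuous fun z => Q z n := (continuous_orthPolyAt a b n).const_mul _
  have hPQ (n : ℕ) (z : ℂ) : orthPolyAt a b n z = (ν : ℂ) ^ n * Q z n := by
    rw [hQdef]; simp only; rw [← mul_assoc, hν2', one_mul]
  have hp : -σ / 2 + 1 / 4 = 1 / 4 - σ / 2 := by ring
  have hpow {n : ℕ} (hn : 1 ≤ n) : (((n : ℝ) ^ (1 / 4 - σ / 2) : ℝ) : ℂ) ≠ 0 := by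
    exact_mod_cast (Real.rpow_pos_of_pos (show (0 : ℝ) < n by exact_mod_cast hn) _).ne'
  rw [hp]
  constructor
  -- oscillating case: `s` is purely imaginary
  · intro hneg
    set s : ℂ := Complex.I * (√|τ| : ℝ) with hsdef
    have habs : 0 < √|τ| := Real.sqrt_pos.2 (abs_pos.2 hneg.ne)
    have hs : s ^ 2 = ((2 * β - 2 * α + σ : ℝ) : ℂ) := by
      rw [← hτ, hsdef, mul_pow, Complex.I_sq, ← Complex.ofReal_pow, Real.sq_sqrt (abs_nonneg _),
        abs_of_neg hneg]
      push_cast; ring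
    have hs0 : s ≠ 0 := mul_ne_zero Complex.I_ne_zero (by exact_mod_cast habs.ne')
    have hsre : s.re = 0 := by simp [hsdef]
    obtain ⟨κm, M₁, hM₁, h₁⟩ :=
      exists_amplitude_limit hs0 hsre.ge hϱ0 hϱ1 hϱ2 ha_asymp hB hs hQ hζ hQc
    -- both ansatz sequences are non-decaying, so the second amplitude is covered by `-s`
    obtain ⟨κp, M₂, hM₂, h₂⟩ := exists_amplitude_limit (s := -s) (neg_ne_zero.2 hs0)
      (by simp [hsre]) hϱ0 hϱ1 hϱ2 ha_asymp hB (by rw [neg_sq, hs]) hQ hζ hQc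
    obtain ⟨_, _, hW⟩ := exists_casoratian_wkbSeq_bound hs0 hϱ2 ha_asymp
    have hwm (n : ℕ) : wkbSeq σ s n = (((n : ℝ) ^ (1 / 4 - σ / 2) : ℝ) : ℂ)
        * Complex.exp (2 * Complex.I * (√(|τ| * n) : ℂ)) := by
      rw [wkbSeq, wkb, Real.sqrt_mul (abs_nonneg _), hsdef]
      push_cast; ring_nf
    have hwp (n : ℕ) : wkbSeq σ (-s) n = (((n : ℝ) ^ (1 / 4 - σ / 2) : ℝ) : ℂ)
        * Complex.exp (-2 * Complex.I * (√(|τ| * n) : ℂ)) := by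
      rw [wkbSeq, wkb, Real.sqrt_mul (abs_nonneg _), hsdef]
      push_cast; ring_nf
    have hem (n : ℕ) : ‖Complex.exp (2 * Complex.I * (√(|τ| * n) : ℂ))‖ = 1 := by
      rw [Complex.norm_exp]; simp
    have hep (n : ℕ) : ‖Complex.exp (-2 * Complex.I * (√(|τ| * n) : ℂ))‖ = 1 := by
      rw [Complex.norm_exp]; simp
    refine ⟨κp, κm, fun n z => Q z n / (((n : ℝ) ^ (1 / 4 - σ / 2) : ℝ) : ℂ)
      - κp z * Complex.exp (-2 * Complex.I * (√(|τ| * n) : ℂ))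
      - κm z * Complex.exp (2 * Complex.I * (√(|τ| * n) : ℂ)),
      uniformBigOOnCompacts_of_continuous_bound (M := fun z => M₂ z + M₁ z) (by fun_prop) ?_, ?_⟩
    · filter_upwards [h₁, h₂, hW, eventually_ge_atTop 1] with n e₁ e₂ hWn hn z
      have hW0 := norm_pos_iff.1 ((norm_pos_iff.2 hs0).trans_le hWn.1)
      have hne := hpow hn
      have e : Q z n / (((n : ℝ) ^ (1 / 4 - σ / 2) : ℝ) : ℂ)
          - κp z * Complex.exp (-2 * Complex.I * (√(|τ| * n) : ℂ))
          - κm z * Complex.exp (2 * Complex.I * (√(|τ| * n) : ℂ))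
          = (amplitude a σ (-s) (Q z) n - κp z)
              * Complex.exp (-2 * Complex.I * (√(|τ| * n) : ℂ))
            + (amplitude a σ s (Q z) n - κm z)
              * Complex.exp (2 * Complex.I * (√(|τ| * n) : ℂ)) := by
        rw [eq_amplitude_mul_add (Q z) hW0, hwm, hwp]
        generalize (((n : ℝ) ^ (1 / 4 - σ / 2) : ℝ) : ℂ) = c at hne ⊢
        field_simp
        ring
      rw [e]
      refine (norm_add_le _ _).trans ?_
      rw [norm_mul, norm_mul, hem, hep, mul_one, mul_one]
      linarith [e₁ z, e₂ z]
    · intro n hn z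
      have hne := hpow hn
      rw [hPQ]
      beta_reduce
      generalize (((n : ℝ) ^ (1 / 4 - σ / 2) : ℝ) : ℂ) = c at hne ⊢
      field_simp
      ring
  -- exponential case: `s` is real and positive
  · intro hpos
    have hr : 0 < √τ := Real.sqrt_pos.2 hpos
    have hs : ((√τ : ℝ) : ℂ) ^ 2 = ((2 * β - 2 * α + σ : ℝ) : ℂ) := by
      rw [← hτ, ← Complex.ofReal_pow, Real.sq_sqrt hpos.le]
    have hs0 : ((√τ : ℝ) : ℂ) ≠ 0 := by exact_mod_cast hr.ne'
    have hsre : 0 < ((√τ : ℝ) : ℂ).re := by simpa using hr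
    obtain ⟨κ, M₁, hM₁, h₁⟩ :=
      exists_amplitude_limit hs0 hsre.le hϱ0 hϱ1 hϱ2 ha_asymp hB hs hQ hζ hQc
    obtain ⟨M₂, hM₂, h₂⟩ := exists_amplitude_neg_bound hsre hϱ0 hϱ1 hϱ2 ha_asymp hB hs hQ hζ hQc
    obtain ⟨_, _, hW⟩ := exists_casoratian_wkbSeq_bound hs0 hϱ2 ha_asymp
    have hw (n : ℕ) : wkbSeq σ (√τ : ℝ) n = (((n : ℝ) ^ (1 / 4 - σ / 2) : ℝ) : ℂ)
        * (Real.exp (2 * √(τ * n)) : ℂ) := by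
      rw [wkbSeq, wkb, Real.sqrt_mul hpos.le]
      push_cast; ring_nf
    set ε : ℕ → ℂ → ℂ := fun n z => Q z n / wkbSeq σ (√τ : ℝ) n - κ z with hε
    have hεO : UniformBigOOnCompacts ε ϱ Set.univ := by
      refine uniformBigOOnCompacts_of_continuous_bound (M := fun z => M₁ z + M₂ z)
        (by fun_prop) ?_
      filter_upwards [h₁, h₂, hW, eventually_ge_atTop 1] with n e₁ e₂ hWn hn z
      have hW0 := norm_pos_iff.1 ((norm_pos_iff.2 hs0).trans_le hWn.1)
      have hne := wkbSeq_ne_zero σ (√τ : ℝ) hn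
      have e : ε n z = (amplitude a σ (√τ : ℝ) (Q z) n - κ z)
          + amplitude a σ (-(√τ : ℝ)) (Q z) n * recessiveRatio (√τ : ℝ) n := by
        rw [hε]
        simp only
        rw [eq_amplitude_mul_add (Q z) hW0, wkbSeq_neg]
        field_simp
        ring
      rw [e]
      refine (norm_add_le _ _).trans ?_
      linarith [e₁ z, e₂ z]
    have hsum (n : ℕ) (z : ℂ) : κ z + ε n z = Q z n / wkbSeq σ (√τ : ℝ) n := by
      rw [hε]; ring
    have hεeq (n : ℕ) (hn : 1 ≤ n) (z : ℂ) : orthPolyAt a b n z =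
        (ν : ℂ) ^ n * (((n : ℝ) ^ (1 / 4 - σ / 2) : ℝ) : ℂ) *
          (Real.exp (2 * √(τ * n)) : ℂ) * (κ z + ε n z) := by
      have hne := wkbSeq_ne_zero σ (√τ : ℝ) hn
      rw [hsum, hPQ, mul_assoc ((ν : ℂ) ^ n), ← hw]
      field_simp
    refine ⟨κ, ⟨ε, hεO, hεeq⟩, ⟨fun n z => ε n z / κ z, hεO.div_limit hϱ0 ?_, ?_⟩, ?_⟩
    · refine Eventually.of_forall fun n => ?_
      simp only [hsum]
      exact (hQc n).div_const _
    · intro n hn z hz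
      rw [hεeq n hn z]
      field_simp
    · intro z
      have hnorm (n : ℕ) : ‖orthPolyAt a b n z‖ = ‖Q z n‖ := by
        rw [hPQ, norm_mul, hνn, one_mul]
      simp only [hnorm]
      constructor
      · intro hz
        refine summable_norm_sq_of_isBigO_wkbSeq hσ hr
          (isBigO_wkbSeq_neg_of_amplitude_tendsto_zero hsre hϱ0 hϱ1 hϱ2 ha_asymp hB hs (hQ z) ?_)
        obtain ⟨N, hN⟩ := eventually_atTop.1 h₁
        exact tendsto_of_norm_sub_le_rpow hϱ0 (N := N) (L := M₁ z) fun n hn => by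
          simpa [hz] using hN n hn z
      · intro hsm
        by_contra hz
        have h0 : Tendsto (fun n => κ z + ε n z) atTop (nhds (κ z)) :=
          (hεO.tendstoUniformlyOn hϱ0 (Set.subset_univ {z}) isCompact_singleton κ).tendsto_at
            (Set.mem_singleton z)
        have hinf := ((tendsto_norm_wkbSeq_atTop σ hr).atTop_mul_pos
          (norm_pos_iff.2 hz) h0.norm)
        have hQinf : Tendsto (fun n => ‖Q z n‖) atTop atTop := by
          refine hinf.congr' ?_
          filter_upwards [eventually_ge_atTop 1] with n hn
          rw [hsum, ← norm_mul, mul_div_cancel₀ _ (wkbSeq_ne_zero σ (√τ : ℝ) hn)]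
        exact not_tendsto_atTop_of_tendsto_nhds hsm.tendsto_atTop_zero
          ((tendsto_pow_atTop two_ne_zero).comp hQinf)
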